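/- Let $k$ be an algebraically closed field of characteristic zero. Let $G$ be a finite group, $\chi\colon G\to k^\times$ a character, $a$ a central element of $G$ such that the order $n$ of $\chi(a)$ is greater than $1$, and $\alpha\in k$ such that $\alpha(a^n-1)=0$ in $k[G]$ or $\chi^n=1$. Let $H$ be the rank one pointed Hopf algebra of $(G,\chi,a,\alpha)$: the algebra generated by $G$ and $x$ subject to the group relations of $G$, $x^n=\alpha(a^n-1)$ and $xg=\chi(g)gx$ for $g\in G$, with $\Delta(g)=g\otimes g$, $\Delta(x)=x\otimes a+1\otimes x$, $\epsilon(g)=1$, $\epsilon(x)=0$. A Hopf $q$-brace structure on a Hopf algebra $H$ is a pair of bilinear operations $\cdot$ and $:$ on $H$, each satisfying $\epsilon(u\cdot v)=\epsilon(u)\epsilon(v)=\epsilon(u:v)$, such that $u\otimes v\mapsto (v_{(1)}:u_{(2)})\otimes(u_{(1)}\cdot v_{(2)})$ is a coalgebra morphism $H\otimes H^{\mathrm{cop}}\to H^{\mathrm{cop}}\otimes H$; the maps $u\otimes v\mapsto (u\cdot v_{(1)})\otimes v_{(2)}$ and $u\otimes v\mapsto (u: v_{(2)})\otimes v_{(1)}$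 are bijective; for all $u,v,w\in H$ $$(u\cdot v_{(1)})\cdot(w:v_{(2)})=(u\cdot w_{(2)})\cdot(v\cdot w_{(1)}),$$ $$(u\cdot v_{(1)}):(w\cdot v_{(2)})=(u:w_{(2)})\cdot(v:w_{(1)}),$$ $$(u:v_{(1)}):(w:v_{(2)})=(u:w_{(2)}):(v\cdot w_{(1)});$$ $H$ is a right $H^{\mathrm{op}}$-module via $\cdot$ and via $:$ (that is, $u\cdot 1=u$, $u\cdot(vw)=(u\cdot w)\cdot v$, and likewise for $:$); and $$uv\cdot w=(u\cdot(w_{(1)}:v_{(2)}))(v_{(1)}\cdot w_{(2)}),\qquad uv:w=(u:(w_{(1)}\cdot v_{(2)}))(v_{(1)}:w_{(2)}).$$ A $q$-brace structure on the group $G$ is a pair of binary operations on $G$ satisfying the same conditions with $\Delta(g)=g\otimes g$, i.e. with every $v_{(1)},v_{(2)}$ replaced by $v$ (and the bijectivity condition read as bijectivity of $g\mapsto g\cdot h$ and $g\mapsto g:h$ for each $h$). **Theorem.** (a) Let $(\cdot,:)$ be a Hopf $q$-brace structure on $H$ with $x\cdot x=x:x=0$. Then it restricts to a $q$-brace structure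 on $G$ such that $a\cdot g=a:g=a$ and $g\cdot a=g:a=g$ for all $g\in G$, and there exist characters $\lambda,\xi\colon G\to k^\times$ such that, for all $h,l\in G$, 1. $\lambda(a)=\xi(a)^{-1}$, 2. $\lambda(h(l:h))=\lambda(l(h\cdot l))$, 3. $\lambda(h)\,\xi(l\cdot h)=\xi(l)\,\lambda(h:l)$, 4. $\xi(l(h\cdot l))=\xi(h(l:h))$, 5. $\chi(h)\lambda(l)=\lambda(l:h)\chi(h\cdot l)$, 6. $\chi(h)\xi(l)=\xi(l\cdot h)\chi(h:l)$, and such that, for all $h,g\in G$ and all integers $j,j'\ge 0$, $$hx^{j}\cdot gx^{j'}=\begin{cases}\lambda(g)^{j}(h\cdot g)x^{j}&\text{if }j'=0,\\0&\text{otherwise,}\end{cases}\qquad hx^{j}:gx^{j'}=\begin{cases}\xi(g)^{j}(h:g)x^{j}&\text{if }j'=0,\\0&\text{otherwise.}\end{cases}\tag{$*$}$$ (b) Conversely, let $G$ carry a $q$-brace structure such that $a\cdot g=a:g=a$ and $g\cdot a=g:a=g$ for all $g\in G$, and let $\lambda,\xi\colon G\to k^\times$ be characters satisfying 1–6. Then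 any bilinear operations on $H$ satisfying $(*)$ for all $h,g\in G$ and $j,j'\ge 0$ form a Hopf $q$-brace structure on $H$. The formulas $(*)$ are well defined, that is, there is one and only one pair of bilinear operations on $H$ satisfying them, if and only if $\alpha(a^n-1)=0$ in $H$ or $\lambda^n=\xi^n=1$. -/

import Mathlib

open scoped TensorProduct

noncomputable section

universe u v

/-! ### Hopf q-braces -/

section CoalgebraMaps

variable {k : Type u} {X : Type v} [CommRing k] [AddCommGroup X] [Module k X]

/-- For a comultiplication `Δ` on `X` and a bilinear operation `p` on `X`, the map
`x ⊗ y ↦ p x y₍₁₎ ⊗ y₍₂₎`. -/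
def gMap (Δ : X →ₗ[k] X ⊗[k] X) (p : X →ₗ[k] X →ₗ[k] X) : X ⊗[k] X →ₗ[k] X ⊗[k] X :=
  TensorProduct.map (TensorProduct.lift p) LinearMap.id ∘ₗ
    (TensorProduct.assoc k X X X).symm.toLinearMap ∘ₗ LinearMap.lTensor X Δ

/-- The comultiplication `x ⊗ y ↦ (x₍₁₎ ⊗ y₍₁₎) ⊗ (x₍₂₎ ⊗ y₍₂₎)` of the tensor product of the
coalgebras with comultiplications `Δ₁` and `Δ₂`. -/
def tensorComul (Δ₁ Δ₂ : X →ₗ[k] X ⊗[k] X) :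
    X ⊗[k] X →ₗ[k] (X ⊗[k] X) ⊗[k] (X ⊗[k] X) :=
  (TensorProduct.tensorTensorTensorComm k X X X X).toLinearMap ∘ₗ TensorProduct.map Δ₁ Δ₂

variable (k X) in
/-- The comultiplication `x ↦ x₍₂₎ ⊗ x₍₁₎` of the co-opposite coalgebra of `X`. -/
def copComul [Coalgebra k X] : X →ₗ[k] X ⊗[k] X :=
  (TensorProduct.comm k X X).toLinearMap ∘ₗ Coalgebra.comul

/-- The map `x ⊗ y ↦ d y₍₁₎ x₍₂₎ ⊗ p x₍₁₎ y₍₂₎`. -/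
def crossMap [Coalgebra k X] (p d : X →ₗ[k] X →ₗ[k] X) : X ⊗[k] X →ₗ[k] X ⊗[k] X :=
  TensorProduct.map (TensorProduct.lift d.flip) (TensorProduct.lift p) ∘ₗ
    tensorComul (copComul k X) Coalgebra.comul

/-- The Sweedler sum `v ↦ B v₍₁₎ v₍₂₎` of a bilinear map `B`. -/
def sweedler [Coalgebra k X] (B : X →ₗ[k] X →ₗ[k] X) : X →ₗ[k] X :=
  TensorProduct.lift B ∘ₗ Coalgebra.comul

theorem sweedler_eq_sum [Coalgebra k X] (B : X →ₗ[k] X →ₗ[k] X) {ι : Type*} (v : X)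
    (r : Coalgebra.Repr k v ι) :
    sweedler B v = ∑ i ∈ r.index, B (r.left i) (r.right i) := by
  simp [sweedler, ← r.eq]

theorem crossMap_eq_sum [Coalgebra k X] (p d : X →ₗ[k] X →ₗ[k] X) {ι κ : Type*} (x y : X)
    (r : Coalgebra.Repr k x ι) (s : Coalgebra.Repr k y κ) :
    crossMap p d (x ⊗ₜ y) = ∑ i ∈ r.index, ∑ j ∈ s.index,
      d (s.left j) (r.right i) ⊗ₜ[k] p (r.left i) (s.right j) := by
  simp [crossMap, tensorComul, copComul, ← r.eq, ← s.eq, TensorProduct.sum_tmul,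
    TensorProduct.tmul_sum]
  rw [Finset.sum_comm]

/-- `(X, p, d)` is a q-magma coalgebra, where `p x y` is `x · y` and `d x y` is `x : y`:
`ε ∘ p = ε ∘ d = ε ⊗ ε`, and `x ⊗ y ↦ y₍₁₎ : x₍₂₎ ⊗ x₍₁₎ · y₍₂₎` is a coalgebra morphism from
`X ⊗ Xᶜᵒᵖ` to `Xᶜᵒᵖ ⊗ X`. -/
structure IsQMagmaCoalgebra [Coalgebra k X] (p d : X →ₗ[k] X →ₗ[k] X) : Prop where
  counit_dot : ∀ x y : X,
    Coalgebra.counit (R := k) (p x y) = Coalgebra.counit (R := k) x * Coalgebra.counit (R := k) y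
  counit_ddot : ∀ x y : X,
    Coalgebra.counit (R := k) (d x y) = Coalgebra.counit (R := k) x * Coalgebra.counit (R := k) y
  counit_cross :
    (LinearMap.mul' k k ∘ₗ TensorProduct.map Coalgebra.counit Coalgebra.counit) ∘ₗ crossMap p d =
      LinearMap.mul' k k ∘ₗ TensorProduct.map Coalgebra.counit Coalgebra.counit
  comul_cross :
    TensorProduct.map (crossMap p d) (crossMap p d) ∘ₗ
        tensorComul Coalgebra.comul (copComul k X) =
      tensorComul (copComul k X) Coalgebra.comul ∘ₗ crossMap p d

/-- A regular q-cycle coalgebra: a q-magma coalgebra that is left and right regular and satisfies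
* `(u · v₍₁₎) · (w : v₍₂₎) = (u · w₍₂₎) · (v · w₍₁₎)`,
* `(u · v₍₁₎) : (w · v₍₂₎) = (u : w₍₂₎) · (v : w₍₁₎)`,
* `(u : v₍₁₎) : (w : v₍₂₎) = (u : w₍₂₎) : (v · w₍₁₎)`.

Left regularity is the invertibility of `x ⊗ y ↦ x · y₍₁₎ ⊗ y₍₂₎`; right regularity is left
regularity of the opposite `(Xᶜᵒᵖ, :, ·)`. -/
structure IsRegularQCycleCoalgebra [Coalgebra k X] (p d : X →ₗ[k] X →ₗ[k] X) : Prop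
    extends IsQMagmaCoalgebra p d where
  left_regular : Function.Bijective (gMap Coalgebra.comul p)
  right_regular : Function.Bijective (gMap (copComul k X) d)
  cycle_one : ∀ u v w : X,
    sweedler (p.compl₁₂ (p u) (d w)) v = sweedler (p.compl₁₂ (p u) (p v)).flip w
  cycle_two : ∀ u v w : X,
    sweedler (d.compl₁₂ (p u) (p w)) v = sweedler (p.compl₁₂ (d u) (d v)).flip w
  cycle_three : ∀ u v w : X,
    sweedler (d.compl₁₂ (d u) (d w)) v = sweedler (d.compl₁₂ (d u) (p v)).flip w

end CoalgebraMaps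

/-- `(H, p, d)` is a Hopf q-brace: a regular q-cycle coalgebra structure on the Hopf algebra `H`
such that `p` and `d` make `H` a right `Hᵒᵖ`-module and
* `hl · m = (h · (m₍₁₎ : l₍₂₎)) (l₍₁₎ · m₍₂₎)`,
* `hl : m = (h : (m₍₁₎ · l₍₂₎)) (l₍₁₎ : m₍₂₎)`. -/
structure IsHopfQBrace {k : Type u} {H : Type v} [Field k] [Ring H] [HopfAlgebra k H]
    (p d : H →ₗ[k] H →ₗ[k] H) : Prop extends IsRegularQCycleCoalgebra p d where
  dot_one : ∀ h : H, p h 1 = h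
  dot_mul : ∀ h l m : H, p h (l * m) = p (p h m) l
  ddot_one : ∀ h : H, d h 1 = h
  ddot_mul : ∀ h l m : H, d h (l * m) = d (d h m) l
  mul_dot : ∀ h l m : H,
    p (h * l) m = LinearMap.mul' k H (LinearMap.rTensor H (p h) (crossMap p d (l ⊗ₜ m)))
  mul_ddot : ∀ h l m : H,
    d (h * l) m = LinearMap.mul' k H (LinearMap.rTensor H (d h) (crossMap d p (l ⊗ₜ m)))

/-- `(G, dot, ddot)` is a q-brace on the group `G`, where `dot g h` is `g · h` and `ddot g h`
is `g : h`: a regular q-cycle set for which `·` and `:` are right `Gᵒᵖ`-actions satisfying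
`gh · l = (g · (l : h)) (h · l)` and `gh : l = (g : (l · h)) (h : l)`. -/
structure IsQBrace {G : Type v} [Group G] (dot ddot : G → G → G) : Prop where
  left_regular : ∀ h : G, Function.Bijective fun g => dot g h
  right_regular : ∀ h : G, Function.Bijective fun g => ddot g h
  cycle_one : ∀ u v w : G, dot (dot u v) (ddot w v) = dot (dot u w) (dot v w)
  cycle_two : ∀ u v w : G, ddot (dot u v) (dot w v) = dot (ddot u w) (ddot v w)
  cycle_three : ∀ u v w : G, ddot (ddot u v) (ddot w v) = ddot (ddot u w) (dot v w)
  dot_one : ∀ g : G, dot g 1 = g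
  dot_mul : ∀ g h l : G, dot g (h * l) = dot (dot g l) h
  ddot_one : ∀ g : G, ddot g 1 = g
  ddot_mul : ∀ g h l : G, ddot g (h * l) = ddot (ddot g l) h
  mul_dot : ∀ g h l : G, dot (g * h) l = dot g (ddot l h) * dot h l
  mul_ddot : ∀ g h l : G, ddot (g * h) l = ddot g (dot l h) * ddot h l

/-! ### A q-binomial identity -/

section QBinomial

variable {k : Type u} [Field k]

/-- Gaussian binomial coefficients. -/
def qBinom (q : k) : ℕ → ℕ → k
  | _, 0 => 1
  | 0, _ + 1 => 0
  | m + 1, j + 1 => qBinom q m j + q ^ (j + 1) * qBinom q m (j + 1)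

theorem qBinom_zero_right (q : k) (m : ℕ) : qBinom q m 0 = 1 := by
  cases m <;> rfl

theorem qBinom_of_lt (q : k) : ∀ m j : ℕ, m < j → qBinom q m j = 0
  | _, 0, h => absurd h (Nat.not_lt_zero _)
  | 0, _ + 1, _ => rfl
  | m + 1, j + 1, h => by
    rw [qBinom, qBinom_of_lt q m j (by omega), qBinom_of_lt q m (j + 1) (by omega)]; simp

theorem qBinom_self (q : k) : ∀ m : ℕ, qBinom q m m = 1
  | 0 => rfl
  | m + 1 => by rw [qBinom, qBinom_self q m, qBinom_of_lt q m (m + 1) (by omega)]; simp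

theorem qBinom_succ_mul (q : k) : ∀ m j : ℕ,
    (q ^ (j + 1) - 1) * qBinom q (m + 1) (j + 1) = (q ^ (m + 1) - 1) * qBinom q m j
  | 0, 0 => by simp [qBinom]
  | 0, j + 1 => by simp [qBinom]
  | m + 1, 0 => by
    have h := qBinom_succ_mul q m 0
    rw [qBinom_zero_right] at h ⊢
    rw [qBinom, qBinom_zero_right]
    linear_combination q * h
  | m + 1, j + 1 => by
    have h := qBinom_succ_mul q m (j + 1)
    have h' := qBinom_succ_mul q m j
    rw [show qBinom q (m + 1 + 1) (j + 1 + 1) = qBinom q (m + 1) (j + 1) +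
      q ^ (j + 1 + 1) * qBinom q (m + 1) (j + 1 + 1) from rfl]
    have e : qBinom q (m + 1) (j + 1) = qBinom q m j + q ^ (j + 1) * qBinom q m (j + 1) := rfl
    linear_combination q ^ (j + 2) * h + q * h' - q * (q ^ (m + 1) - 1) * e

theorem qBinom_eq_zero {q : k} {n : ℕ} (hq : IsPrimitiveRoot q n) {j : ℕ} (h0 : 0 < j)
    (hn : j < n) : qBinom q n j = 0 := by
  obtain ⟨i, rfl⟩ : ∃ i, j = i + 1 := ⟨j - 1, by omega⟩
  obtain ⟨m, rfl⟩ : ∃ m, n = m + 1 := ⟨n - 1, by omega⟩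
  have h := qBinom_succ_mul q m i
  rw [hq.pow_eq_one, sub_self, zero_mul] at h
  refine (mul_eq_zero.1 h).resolve_left fun h1 => ?_
  exact hq.pow_ne_one_of_pos_of_lt (by omega) hn (sub_eq_zero.1 h1)

theorem q_add_pow {A : Type v} [Ring A] [Algebra k A] (q : k) (a b : A)
    (hab : b * a = q • (a * b)) (m : ℕ) :
    (a + b) ^ m = ∑ j ∈ Finset.range (m + 1), qBinom q m j • (a ^ j * b ^ (m - j)) := by
  have hb : ∀ j : ℕ, b * a ^ j = q ^ j • (a ^ j * b) := by
    intro j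
    induction j with
    | zero => simp
    | succ j ih =>
      rw [pow_succ, ← mul_assoc, ih, smul_mul_assoc, mul_assoc, hab, mul_smul_comm, smul_smul,
        ← mul_assoc, pow_succ]
  induction m with
  | zero => simp [qBinom]
  | succ m ih =>
    rw [pow_succ', ih, add_mul, Finset.mul_sum, Finset.mul_sum, Finset.sum_range_succ' _ (m + 1)]
    have h1 : ∀ j ∈ Finset.range (m + 1),
        qBinom q (m + 1) (j + 1) • (a ^ (j + 1) * b ^ (m + 1 - (j + 1))) =
          a * qBinom q m j • (a ^ j * b ^ (m - j)) +
            (q ^ (j + 1) * qBinom q m (j + 1)) • (a ^ (j + 1) * b ^ (m - j)) := by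
      intro j _
      rw [qBinom, add_smul, mul_smul_comm, ← mul_assoc, ← pow_succ', Nat.succ_sub_succ]
    rw [Finset.sum_congr rfl h1, Finset.sum_add_distrib, add_assoc]
    congr 1
    have h2 : ∀ j ∈ Finset.range (m + 1), b * qBinom q m j • (a ^ j * b ^ (m - j)) =
        (q ^ j * qBinom q m j) • (a ^ j * b ^ (m + 1 - j)) := by
      intro j hj
      have hj' : j ≤ m := by simpa [Nat.lt_succ_iff] using hj
      rw [mul_smul_comm, ← mul_assoc, hb, smul_mul_assoc, smul_smul, mul_assoc, ← pow_succ',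
        mul_comm (q ^ j), Nat.succ_sub hj']
    rw [Finset.sum_congr rfl h2, Finset.sum_range_succ', Finset.sum_range_succ]
    rw [qBinom_of_lt q m (m + 1) (by omega)]
    simp only [qBinom_zero_right, mul_zero, zero_smul, add_zero, pow_zero, one_mul,
      Nat.succ_sub_succ, Nat.sub_zero]

theorem q_add_pow_eq {A : Type v} [Ring A] [Algebra k A] {q : k} {n : ℕ} (hn : 0 < n)
    (hq : IsPrimitiveRoot q n) (a b : A) (hab : b * a = q • (a * b)) :
    (a + b) ^ n = a ^ n + b ^ n := by
  rw [q_add_pow q a b hab, Finset.sum_range_succ, ← Finset.insert_erase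
    (Finset.mem_range.2 hn), Finset.sum_insert (by simp), Finset.sum_eq_zero]
  · simp [qBinom_zero_right, qBinom_self, add_comm]
  · intro j hj
    rw [Finset.mem_erase, Finset.mem_range] at hj
    rw [qBinom_eq_zero hq (by omega) hj.2, zero_smul]

theorem neg_one_pow_mul_prod_pow {q : k} {n : ℕ} (hn : 0 < n) (hq : IsPrimitiveRoot q n) :
    (-1 : k) ^ n * ∏ i ∈ Finset.range n, q ^ i = -1 := by
  rw [Finset.prod_pow_eq_pow_sum]
  rcases Nat.even_or_odd' n with ⟨m, rfl | rfl⟩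
  · have hm : (q ^ m) = -1 := by
      have h1 : (q ^ m) * (q ^ m) = 1 := by rw [← pow_add, ← two_mul, hq.pow_eq_one]
      exact (mul_self_eq_one_iff.1 h1).resolve_left
        (hq.pow_ne_one_of_pos_of_lt (by omega) (by omega))
    have hs : ∑ i ∈ Finset.range (2 * m), i = m * (2 * m - 1) := by
      have := Finset.sum_range_id_mul_two (2 * m)
      have h2 : 2 * m * (2 * m - 1) = m * (2 * m - 1) * 2 := by ring
      omega
    rw [hs, pow_mul q, hm, ← pow_add]
    have : Odd (2 * m + (2 * m - 1)) := ⟨2 * m - 1, by omega⟩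
    exact this.neg_one_pow
  · have hs : ∑ i ∈ Finset.range (2 * m + 1), i = (2 * m + 1) * m := by
      have := Finset.sum_range_id_mul_two (2 * m + 1)
      have h2 : (2 * m + 1) * (2 * m + 1 - 1) = (2 * m + 1) * m * 2 := by
        rw [Nat.add_sub_cancel]; ring
      omega
    rw [hs, pow_mul q, hq.pow_eq_one, one_pow, mul_one]
    exact Odd.neg_one_pow ⟨m, rfl⟩

end QBinomial

/-! ### Rank one pointed Hopf algebras -/

/-- A datum `(G, χ, a, α)`: a `kˣ`-valued character `χ` of `G`, a central element `a` such that
the order `n` of `χ a` is greater than `1`, and a scalar `α` such that `α (aⁿ - 1) = 0` in `k[G]`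
or `χⁿ = 1`. -/
structure RankOneDatum (k : Type u) (G : Type v) [Field k] [Group G] where
  χ : G →* kˣ
  a : G
  α : k
  a_central : a ∈ Subgroup.center G
  one_lt_order : 1 < orderOf (χ a)
  compat : α • (MonoidAlgebra.of k G (a ^ orderOf (χ a)) - 1) = 0 ∨ χ ^ orderOf (χ a) = 1

namespace RankOneDatum

variable {k : Type u} {G : Type v} [Field k] [Group G]

/-- The order `n` of `χ a`. -/
def n (D : RankOneDatum k G) : ℕ := orderOf (D.χ D.a)

theorem n_pos (D : RankOneDatum k G) : 0 < D.n := lt_trans one_pos D.one_lt_order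

theorem isPrimitiveRoot (D : RankOneDatum k G) :
    IsPrimitiveRoot ((D.χ D.a : kˣ) : k) D.n :=
  IsPrimitiveRoot.coe_units_iff.2 (IsPrimitiveRoot.orderOf (D.χ D.a))

/-- The defining relations of the rank one pointed Hopf algebra, on the free algebra with
generators the elements of `G` (as `some g`) and `x` (as `none`). -/
inductive Rel (D : RankOneDatum k G) :
    FreeAlgebra k (Option G) → FreeAlgebra k (Option G) → Prop
  | one : Rel D (FreeAlgebra.ι k (some 1)) 1
  | mul (g h : G) : Rel D (FreeAlgebra.ι k (some g) * FreeAlgebra.ι k (some h))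
      (FreeAlgebra.ι k (some (g * h)))
  | pow : Rel D (FreeAlgebra.ι k none ^ D.n) (D.α • (FreeAlgebra.ι k (some D.a) ^ D.n - 1))
  | comm (g : G) : Rel D (FreeAlgebra.ι k none * FreeAlgebra.ι k (some g))
      ((D.χ g : k) • (FreeAlgebra.ι k (some g) * FreeAlgebra.ι k none))

/-- The rank one pointed Hopf algebra `H_D`: generated by `G` and `x` subject to the group
relations, `xⁿ = α (aⁿ - 1)` and `x g = χ(g) g x`. -/
def Alg (D : RankOneDatum k G) : Type (max u v) := RingQuot D.Rel

instance (D : RankOneDatum k G) : Ring D.Alg := inferInstanceAs (Ring (RingQuot D.Rel))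

instance (D : RankOneDatum k G) : Algebra k D.Alg := inferInstanceAs (Algebra k (RingQuot D.Rel))

/-- The canonical projection from the free algebra. -/
def proj (D : RankOneDatum k G) : FreeAlgebra k (Option G) →ₐ[k] D.Alg :=
  RingQuot.mkAlgHom k D.Rel

theorem proj_rel (D : RankOneDatum k G) {s t : FreeAlgebra k (Option G)} (h : D.Rel s t) :
    D.proj s = D.proj t :=
  RingQuot.mkAlgHom_rel k h

/-- The image in `H_D` of the elements of `G`. -/
def grp (D : RankOneDatum k G) : G →* D.Alg where
  toFun g := D.proj (FreeAlgebra.ι k (some g))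
  map_one' := by rw [D.proj_rel Rel.one, map_one]
  map_mul' g h := by rw [← D.proj_rel (Rel.mul g h), map_mul]

/-- The generator `x` of `H_D`. -/
def x (D : RankOneDatum k G) : D.Alg := D.proj (FreeAlgebra.ι k none)

theorem x_pow (D : RankOneDatum k G) : D.x ^ D.n = D.α • (D.grp D.a ^ D.n - 1) := by
  have h := D.proj_rel Rel.pow
  simp only [map_pow, map_smul, map_sub, map_one] at h
  exact h

theorem x_mul_grp (D : RankOneDatum k G) (g : G) :
    D.x * D.grp g = (D.χ g : k) • (D.grp g * D.x) := by
  have h := D.proj_rel (Rel.comm g)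
  simp only [map_mul, map_smul] at h
  exact h

section Lift

variable {A : Type*} [Ring A] [Algebra k A]

/-- The universal property of `H_D` as an algebra. -/
def lift (D : RankOneDatum k G) (f : G →* A) (y : A)
    (hpow : y ^ D.n = D.α • (f D.a ^ D.n - 1))
    (hcomm : ∀ g, y * f g = (D.χ g : k) • (f g * y)) : D.Alg →ₐ[k] A :=
  RingQuot.liftAlgHom k ⟨FreeAlgebra.lift k fun o => Option.elim o y f, by
    intro s t h
    cases h with
    | one => simp
    | mul g h => simp
    | pow => simpa using hpow
    | comm g => simpa using hcomm g⟩

theorem lift_grp (D : RankOneDatum k G) (f : G →* A) (y : A) (hpow) (hcomm) (g : G) :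
    D.lift f y hpow hcomm (D.grp g) = f g := by
  refine (RingQuot.liftAlgHom_mkAlgHom_apply _ _ _ (FreeAlgebra.ι k (some g))).trans ?_
  simp

theorem lift_x (D : RankOneDatum k G) (f : G →* A) (y : A) (hpow) (hcomm) :
    D.lift f y hpow hcomm D.x = y := by
  refine (RingQuot.liftAlgHom_mkAlgHom_apply _ _ _ (FreeAlgebra.ι k none)).trans ?_
  simp

theorem algHom_ext (D : RankOneDatum k G) {B : Type*} [Semiring B] [Algebra k B]
    {φ ψ : D.Alg →ₐ[k] B} (hg : ∀ g, φ (D.grp g) = ψ (D.grp g)) (hx : φ D.x = ψ D.x) : φ = ψ := by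
  refine RingQuot.ringQuot_ext' (s := D.Rel) k φ ψ (FreeAlgebra.hom_ext (funext fun o => ?_))
  cases o with
  | none => exact hx
  | some g => exact hg g

end Lift

theorem induction (D : RankOneDatum k G) {P : D.Alg → Prop} (hk : ∀ c : k, P (algebraMap k D.Alg c))
    (hg : ∀ g, P (D.grp g)) (hx : P D.x) (hadd : ∀ s t, P s → P t → P (s + t))
    (hmul : ∀ s t, P s → P t → P (s * t)) (s : D.Alg) : P s := by
  obtain ⟨t, rfl⟩ := RingQuot.mkAlgHom_surjective k D.Rel s
  change P (D.proj t)
  induction t using FreeAlgebra.induction with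
  | grade0 c => simpa using hk c
  | grade1 o =>
    cases o with
    | none => exact hx
    | some g => exact hg g
  | mul s t hs ht => simpa using hmul _ _ hs ht
  | add s t hs ht => simpa using hadd _ _ hs ht

/-- The map `g ↦ g ⊗ g`. -/
def grpTmul (D : RankOneDatum k G) : G →* D.Alg ⊗[k] D.Alg where
  toFun g := D.grp g ⊗ₜ D.grp g
  map_one' := by simp [Algebra.TensorProduct.one_def]
  map_mul' := by simp

theorem grpTmul_apply (D : RankOneDatum k G) (g : G) : D.grpTmul g = D.grp g ⊗ₜ D.grp g := rfl

/-- The comultiplication: `Δ g = g ⊗ g` and `Δ x = x ⊗ a + 1 ⊗ x`. -/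
def comulHom (D : RankOneDatum k G) : D.Alg →ₐ[k] D.Alg ⊗[k] D.Alg :=
  D.lift D.grpTmul (D.x ⊗ₜ D.grp D.a + 1 ⊗ₜ D.x)
    (by
      rw [q_add_pow_eq D.n_pos D.isPrimitiveRoot]
      · simp only [Algebra.TensorProduct.tmul_pow, x_pow, one_pow, grpTmul_apply]
        rw [← TensorProduct.smul_tmul', TensorProduct.tmul_smul, ← smul_add,
          TensorProduct.sub_tmul, TensorProduct.tmul_sub, Algebra.TensorProduct.one_def]
        congr 1
        abel
      · simp [x_mul_grp, TensorProduct.tmul_smul])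
    (by
      intro g
      have hc : D.grp D.a * D.grp g = D.grp g * D.grp D.a := by
        rw [← map_mul, ← map_mul, Subgroup.mem_center_iff.1 D.a_central g]
      simp [grpTmul_apply, add_mul, mul_add, x_mul_grp, hc, TensorProduct.tmul_smul, TensorProduct.smul_tmul'])

theorem comulHom_grp (D : RankOneDatum k G) (g : G) :
    D.comulHom (D.grp g) = D.grp g ⊗ₜ D.grp g := D.lift_grp _ _ _ _ g

theorem comulHom_x (D : RankOneDatum k G) :
    D.comulHom D.x = D.x ⊗ₜ D.grp D.a + 1 ⊗ₜ D.x := D.lift_x _ _ _ _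

/-- The counit: `ε g = 1` and `ε x = 0`. -/
def counitHom (D : RankOneDatum k G) : D.Alg →ₐ[k] k :=
  D.lift 1 0 (by simp [D.n_pos.ne']) (by simp)

theorem counitHom_grp (D : RankOneDatum k G) (g : G) : D.counitHom (D.grp g) = 1 :=
  D.lift_grp _ _ _ _ g

theorem counitHom_x (D : RankOneDatum k G) : D.counitHom D.x = 0 := D.lift_x _ _ _ _

instance (D : RankOneDatum k G) : Bialgebra k D.Alg :=
  Bialgebra.ofAlgHom D.comulHom D.counitHom
    (by
      apply D.algHom_ext
      · intro g
        simp [comulHom_grp]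
      · simp [comulHom_x, comulHom_grp, TensorProduct.add_tmul, TensorProduct.tmul_add,
          Algebra.TensorProduct.one_def, add_assoc])
    (by
      apply D.algHom_ext
      · intro g
        simp [comulHom_grp, counitHom_grp]
      · simp [comulHom_x, counitHom_x])
    (by
      apply D.algHom_ext
      · intro g
        simp [comulHom_grp, counitHom_grp]
      · simp [comulHom_x, counitHom_x, counitHom_grp])

theorem comul_eq (D : RankOneDatum k G) (s : D.Alg) :
    Coalgebra.comul (R := k) s = D.comulHom s := rfl

theorem counit_eq (D : RankOneDatum k G) (s : D.Alg) :
    Coalgebra.counit (R := k) s = D.counitHom s := rfl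

theorem grp_inv_mul_x (D : RankOneDatum k G) (g : G) :
    D.grp g⁻¹ * D.x = (D.χ g : k) • (D.x * D.grp g⁻¹) := by
  rw [x_mul_grp, smul_smul]
  simp

theorem x_mul_grp_inv_pow (D : RankOneDatum k G) (m : ℕ) :
    (D.x * D.grp D.a⁻¹) ^ m =
      (∏ i ∈ Finset.range m, (D.χ D.a : k) ^ i) • (D.x ^ m * D.grp D.a⁻¹ ^ m) := by
  have hb : ∀ j : ℕ, D.grp D.a⁻¹ ^ j * D.x = (D.χ D.a : k) ^ j • (D.x * D.grp D.a⁻¹ ^ j) := by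
    intro j
    rw [← map_pow, inv_pow, grp_inv_mul_x]
    simp
  induction m with
  | zero => simp
  | succ m ih =>
    rw [pow_succ, ih, smul_mul_assoc, mul_assoc, ← mul_assoc _ D.x, hb, smul_mul_assoc,
      mul_smul_comm, smul_smul, Finset.prod_range_succ]
    simp only [pow_succ, mul_assoc]

/-- The antipode as an algebra map to the opposite algebra: `S g = g⁻¹` and `S x = -x a⁻¹`. -/
def antipodeHom (D : RankOneDatum k G) : D.Alg →ₐ[k] D.Algᵐᵒᵖ :=
  D.lift
    { toFun := fun g => MulOpposite.op (D.grp g⁻¹)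
      map_one' := by simp
      map_mul' := by intro g h; simp [← MulOpposite.op_mul] }
    (MulOpposite.op (-(D.x * D.grp D.a⁻¹)))
    (by
      rw [← MulOpposite.op_pow, neg_pow, x_mul_grp_inv_pow]
      have h := neg_one_pow_mul_prod_pow D.n_pos D.isPrimitiveRoot
      have h1 : ((-1 : D.Alg)) ^ D.n = algebraMap k D.Alg ((-1) ^ D.n) := by simp
      rw [h1, ← Algebra.smul_def, smul_smul, h, x_pow, smul_mul_assoc, sub_mul, ← map_pow, ← map_pow,
        ← map_mul]
      simp only [inv_pow, mul_inv_cancel, map_one, MonoidHom.coe_mk, OneHom.coe_mk, one_mul,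
        ← MulOpposite.op_pow, ← map_pow]
      rw [← MulOpposite.op_one, ← MulOpposite.op_sub, ← MulOpposite.op_smul]
      congr 1
      rw [neg_smul, one_smul, ← smul_neg, neg_sub])
    (by
      intro g
      have hc : D.grp D.a⁻¹ * D.grp g⁻¹ = D.grp g⁻¹ * D.grp D.a⁻¹ := by
        rw [← map_mul, ← map_mul, ← mul_inv_rev, ← mul_inv_rev,
          Subgroup.mem_center_iff.1 D.a_central g]
      simp only [MonoidHom.coe_mk, OneHom.coe_mk, ← MulOpposite.op_mul, ← MulOpposite.op_smul]
      congr 1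
      rw [mul_neg, neg_mul, smul_neg, ← mul_assoc, grp_inv_mul_x, smul_mul_assoc, mul_assoc,
        mul_assoc, hc])

/-- The antipode. -/
def antipodeLin (D : RankOneDatum k G) : D.Alg →ₗ[k] D.Alg :=
  (MulOpposite.opLinearEquiv k).symm.toLinearMap ∘ₗ D.antipodeHom.toLinearMap

theorem antipodeLin_grp (D : RankOneDatum k G) (g : G) :
    D.antipodeLin (D.grp g) = D.grp g⁻¹ := by
  simp only [antipodeLin, LinearMap.comp_apply, AlgHom.toLinearMap_apply, antipodeHom, lift_grp]
  rfl

theorem antipodeLin_x (D : RankOneDatum k G) :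
    D.antipodeLin D.x = -(D.x * D.grp D.a⁻¹) := by
  simp only [antipodeLin, LinearMap.comp_apply, AlgHom.toLinearMap_apply, antipodeHom, lift_x]
  rfl

theorem antipodeLin_mul (D : RankOneDatum k G) (s t : D.Alg) :
    D.antipodeLin (s * t) = D.antipodeLin t * D.antipodeLin s := by
  simp [antipodeLin]

theorem antipodeLin_algebraMap (D : RankOneDatum k G) (c : k) :
    D.antipodeLin (algebraMap k D.Alg c) = algebraMap k D.Alg c := by
  simp [antipodeLin]

theorem antipode_left (D : RankOneDatum k G) (s : D.Alg) :
    LinearMap.mul' k D.Alg (D.antipodeLin.rTensor D.Alg (D.comulHom s)) =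
      algebraMap k D.Alg (D.counitHom s) := by
  induction s using D.induction with
  | hk c =>
    rw [AlgHom.commutes, AlgHom.commutes, Algebra.TensorProduct.algebraMap_apply]
    rw [← mul_one (algebraMap k D.Alg c), ← Algebra.smul_def]
    have h1 : D.antipodeLin 1 = 1 := by simpa using D.antipodeLin_algebraMap 1
    simp [h1, Algebra.algebraMap_eq_smul_one]
  | hg g => simp [comulHom_grp, counitHom_grp, antipodeLin_grp, ← map_mul]
  | hx =>
    have h1 : D.antipodeLin 1 = 1 := by simpa using D.antipodeLin_algebraMap 1
    simp [comulHom_x, counitHom_x, antipodeLin_x, h1, mul_assoc, ← map_mul]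
  | hadd s t hs ht => simp [hs, ht]
  | hmul s t hs ht =>
    have key : ∀ (U V : D.Alg ⊗[k] D.Alg) (c : k),
        LinearMap.mul' k D.Alg (D.antipodeLin.rTensor D.Alg U) = algebraMap k D.Alg c →
        LinearMap.mul' k D.Alg (D.antipodeLin.rTensor D.Alg (U * V)) =
          c • LinearMap.mul' k D.Alg (D.antipodeLin.rTensor D.Alg V) := by
      intro U V c hU
      have h1 : ∀ v w : D.Alg,
          LinearMap.mul' k D.Alg (D.antipodeLin.rTensor D.Alg (U * (v ⊗ₜ w))) =
            D.antipodeLin v *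
              LinearMap.mul' k D.Alg (D.antipodeLin.rTensor D.Alg U) * w := by
        intro v w
        clear hU
        induction U with
        | zero => simp
        | tmul a b => simp [antipodeLin_mul, mul_assoc]
        | add a b ha hb => simp only [add_mul, map_add, ha, hb, mul_add]
      induction V with
      | zero => simp
      | tmul v w =>
        rw [h1, hU, ← Algebra.commutes, mul_assoc, ← Algebra.smul_def]
        simp
      | add a b ha hb => simp only [mul_add, map_add, ha, hb, smul_add]
    rw [map_mul, key _ _ _ hs, ht, map_mul, map_mul, Algebra.smul_def]

theorem antipode_right (D : RankOneDatum k G) (s : D.Alg) :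
    LinearMap.mul' k D.Alg (D.antipodeLin.lTensor D.Alg (D.comulHom s)) =
      algebraMap k D.Alg (D.counitHom s) := by
  induction s using D.induction with
  | hk c =>
    rw [AlgHom.commutes, AlgHom.commutes, Algebra.TensorProduct.algebraMap_apply]
    have h1 : D.antipodeLin 1 = 1 := by simpa using D.antipodeLin_algebraMap 1
    simp [h1]
  | hg g => simp [comulHom_grp, counitHom_grp, antipodeLin_grp, ← map_mul]
  | hx => simp [comulHom_x, counitHom_x, antipodeLin_x, antipodeLin_grp]
  | hadd s t hs ht => simp [hs, ht]
  | hmul s t hs ht =>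
    have key : ∀ (U V : D.Alg ⊗[k] D.Alg) (c : k),
        LinearMap.mul' k D.Alg (D.antipodeLin.lTensor D.Alg V) = algebraMap k D.Alg c →
        LinearMap.mul' k D.Alg (D.antipodeLin.lTensor D.Alg (U * V)) =
          c • LinearMap.mul' k D.Alg (D.antipodeLin.lTensor D.Alg U) := by
      intro U V c hV
      have h1 : ∀ v w : D.Alg,
          LinearMap.mul' k D.Alg (D.antipodeLin.lTensor D.Alg ((v ⊗ₜ w) * V)) =
            v * LinearMap.mul' k D.Alg (D.antipodeLin.lTensor D.Alg V) * D.antipodeLin w := by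
        intro v w
        clear hV
        induction V with
        | zero => simp
        | tmul a b => simp [antipodeLin_mul, mul_assoc]
        | add a b ha hb => simp only [mul_add, map_add, ha, hb, add_mul]
      induction U with
      | zero => simp
      | tmul v w =>
        rw [h1, hV, ← Algebra.commutes, mul_assoc, ← Algebra.smul_def]
        simp
      | add a b ha hb => simp only [add_mul, map_add, ha, hb, smul_add]
    rw [map_mul, key _ _ _ ht, hs, map_mul, map_mul, Algebra.smul_def, ← Algebra.commutes]

instance (D : RankOneDatum k G) : HopfAlgebra k D.Alg where
  antipode := D.antipodeLin
  mul_antipode_rTensor_comul := LinearMap.ext D.antipode_left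
  mul_antipode_lTensor_comul := LinearMap.ext D.antipode_right

/-! ### The explicit structures -/

/-- `a · g = a : g = a` and `g · a = g : a = g` for all `g`. -/
def FixesA (D : RankOneDatum k G) (dot ddot : G → G → G) : Prop :=
  ∀ g : G, dot D.a g = D.a ∧ ddot D.a g = D.a ∧ dot g D.a = g ∧ ddot g D.a = g

/-- The six compatibility conditions between the characters `lam`, `xi`, the character `χ` and
the operations on `G`. -/
structure CompatibleCharacters (D : RankOneDatum k G) (dot ddot : G → G → G)
    (lam xi : G →* kˣ) : Prop where
  one : lam D.a = (xi D.a)⁻¹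
  two : ∀ h l : G, lam (h * ddot l h) = lam (l * dot h l)
  three : ∀ h l : G, lam h * xi (dot l h) = xi l * lam (ddot h l)
  four : ∀ h l : G, xi (l * dot h l) = xi (h * ddot l h)
  five : ∀ h l : G, D.χ h * lam l = lam (ddot l h) * D.χ (dot h l)
  six : ∀ h l : G, D.χ h * xi l = xi (dot l h) * D.χ (ddot h l)

/-- The operation `p` on `H_D` is given by
`p (h xʲ) (g xⁱ) = lam(g)ʲ (dot h g) xʲ` if `i = 0`, and `0` otherwise. -/
def GivenBy (D : RankOneDatum k G) (p : D.Alg →ₗ[k] D.Alg →ₗ[k] D.Alg) (dot : G → G → G)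
    (lam : G →* kˣ) : Prop :=
  ∀ (h g : G) (j i : ℕ), p (D.grp h * D.x ^ j) (D.grp g * D.x ^ i) =
    if i = 0 then (lam g : k) ^ j • (D.grp (dot h g) * D.x ^ j) else 0

end RankOneDatum

end

/-! Everything rests on the basis of monomials `g xʲ` with `j < n`. Its independence comes from a
representation on sequences in `k[G]` on which `x` acts as the shift (`rep`, `coeff`). Since `1 ⊗ x`
and `x ⊗ a` q-commute with `q = χ(a)`, the q-binomial theorem gives `Δ(g xᵐ)` (`comul_mono`).

For the converse direction, an operation given by `(∗)` kills every second argument containing `x`.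
Each Sweedler sum over monomials then collapses to a single term, so every Hopf axiom becomes a
group axiom together with an identity of scalars. Condition 1 handles the cross map, 2–4 the cycle
identities, 5 and 6 the multiplicativity formulas; regularity follows from finite dimension. As for
existence, the formulas define operations on the basis, and the only question is whether they
respect `xⁿ = α(aⁿ - 1)`. Letting `g` act on this relation shows that `λ(g)ⁿ` and `ξ(g)ⁿ` must fix
`α(aⁿ - 1)`, which is the stated criterion.

For the direct statement, group-like elements of `H` lie in `G` (`exists_grp_eq`), so the operations
restrict to `G`. The element `x · g` is skew-primitive, hence of the form `c x + v` with `v ∈ k[G]`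
(`skewPrimitive_sub_mem`). Here `c ≠ 0`, because `g` acts invertibly and preserves `k[G]`; this
forces `a · g = a`. The cross map has two expressions, one in each order of the Sweedler legs
(`crossMap_eq`); comparing them at `x ⊗ g` gives `g : a = g` and `g : x = 0`, and at `x ⊗ x` it
gives `λ(a) ξ(a) = 1`. Acting on `x a = χ(a) a x` kills `v`, since `v` commutes with `a` and `χ(a) ≠
1` (`x_apply`). Thus `x · g = λ(g) x`, and the multiplicativity and module laws propagate this to
all monomials. Exchanging `·` and `:` is a symmetry of the axioms, so each argument is made once and
used twice. -/

namespace RankOneDatum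

noncomputable section

variable {k : Type u} {G : Type v} [Field k] [Group G]

/-! ### A faithful representation and the monomial basis -/

/-- The element `α (aⁿ - 1)` of the group algebra. -/
def powElt (D : RankOneDatum k G) : MonoidAlgebra k G :=
  D.α • (MonoidAlgebra.of k G (D.a ^ D.n) - 1)

theorem powElt_comm (D : RankOneDatum k G) (g : G) :
    D.powElt * MonoidAlgebra.of k G g = MonoidAlgebra.of k G g * D.powElt := by
  have h : g * D.a ^ D.n = D.a ^ D.n * g :=
    (Commute.pow_right (Subgroup.mem_center_iff.1 D.a_central g) D.n)
  simp only [powElt, smul_mul_assoc, mul_smul_comm, sub_mul, mul_sub, ← map_mul, one_mul, mul_one,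
    h]

/-- This is what the alternative in `compat` provides: the twisted action of `g` preserves the
recursion defining `seqSpace`. -/
theorem chi_pow_smul_powElt (D : RankOneDatum k G) (g : G) :
    (D.χ g : k) ^ D.n • D.powElt = D.powElt := by
  rcases D.compat with h | h
  · have : D.powElt = 0 := h
    rw [this, smul_zero]
  · have : D.χ g ^ D.n = 1 := DFunLike.congr_fun h g
    rw [← Units.val_pow_eq_pow_val, this, Units.val_one, one_smul]

/-- The sequences `f` in `k[G]` with `f (i + n) = α (aⁿ - 1) f i`. -/
def seqSpace (D : RankOneDatum k G) : Submodule k (ℕ → MonoidAlgebra k G) where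
  carrier := {f | ∀ i, f (i + D.n) = D.powElt * f i}
  add_mem' := by
    intro f g hf hg i
    simp [hf i, hg i, mul_add]
  zero_mem' := by intro i; simp
  smul_mem' := by
    intro c f hf i
    simp [hf i]

/-- The shift of sequences. -/
def shift (D : RankOneDatum k G) : Module.End k D.seqSpace where
  toFun f := ⟨fun i => f.1 (i + 1), fun i => by
    have := f.2 (i + 1)
    rwa [add_right_comm] at this⟩
  map_add' _ _ := rfl
  map_smul' _ _ := rfl

theorem shift_pow_apply (D : RankOneDatum k G) (m : ℕ) (f : D.seqSpace) (i : ℕ) :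
    ((D.shift ^ m) f).1 i = f.1 (i + m) := by
  induction m generalizing f with
  | zero => rfl
  | succ m ih =>
    rw [pow_succ, Module.End.mul_apply, ih]
    exact congrArg f.1 (add_assoc i m 1)

/-- The action of `G` on sequences by `(g f) i = χ(g)ⁱ g (f i)`. -/
def grpAct (D : RankOneDatum k G) : G →* Module.End k D.seqSpace where
  toFun g :=
    { toFun := fun f => ⟨fun i => (D.χ g : k) ^ i • (MonoidAlgebra.of k G g * f.1 i), fun i => by
        have h := f.2 i
        have e := D.chi_pow_smul_powElt g
        change _ • (_ * f.1 (i + D.n)) = _ * (_ • _)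
        rw [h, ← mul_assoc, ← powElt_comm, mul_assoc, pow_add, mul_smul, ← smul_mul_assoc, e,
          mul_smul_comm]⟩
      map_add' := fun f f' => Subtype.ext <| funext fun i => by simp [mul_add]
      map_smul' := fun c f => Subtype.ext <| funext fun i => by simp [smul_comm c] }
  map_one' := by
    refine LinearMap.ext fun f => Subtype.ext <| funext fun i => ?_
    simp [← MonoidAlgebra.one_def]
  map_mul' g h := by
    refine LinearMap.ext fun f => Subtype.ext <| funext fun i => ?_
    simp only [map_mul, Units.val_mul, LinearMap.coe_mk, AddHom.coe_mk, Module.End.mul_apply,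
      mul_smul_comm, smul_smul, mul_assoc, mul_pow]

theorem grpAct_apply (D : RankOneDatum k G) (g : G) (f : D.seqSpace) (i : ℕ) :
    (D.grpAct g f).1 i = (D.χ g : k) ^ i • (MonoidAlgebra.of k G g * f.1 i) := rfl

/-- The representation of `H_D` on sequences. -/
def rep (D : RankOneDatum k G) : D.Alg →ₐ[k] Module.End k D.seqSpace :=
  D.lift D.grpAct D.shift
    (by
      refine LinearMap.ext fun f => Subtype.ext <| funext fun i => ?_
      rw [shift_pow_apply, f.2 i, ← map_pow]
      -- As `χ(a)` has order `n`, the element `aⁿ` multiplies all entries without a twist.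
      have h : ((D.χ (D.a ^ D.n) : kˣ) : k) = 1 := by
        rw [map_pow, Units.val_pow_eq_pow_val, D.isPrimitiveRoot.pow_eq_one]
      simp only [LinearMap.smul_apply, LinearMap.sub_apply, Module.End.one_apply,
        Submodule.coe_smul, Submodule.coe_sub, Pi.smul_apply, Pi.sub_apply, grpAct_apply, h,
        one_pow, one_smul, powElt, smul_mul_assoc, sub_mul, one_mul])
    (by
      intro g
      refine LinearMap.ext fun f => Subtype.ext <| funext fun i => ?_
      change (D.χ g : k) ^ (i + 1) • (MonoidAlgebra.of k G g * f.1 (i + 1)) =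
        (D.χ g : k) • (D.χ g : k) ^ i • (MonoidAlgebra.of k G g * f.1 (i + 1))
      rw [smul_smul, pow_succ'])

/-- The entry at `0` is untwisted, so it reads off `g` and the `j`-th entry of `f`; sequences
concentrated in one residue then separate the monomials. -/
theorem rep_grp_mul_x_pow (D : RankOneDatum k G) (g : G) (j : ℕ) (f : D.seqSpace) :
    (D.rep (D.grp g * D.x ^ j) f).1 0 = MonoidAlgebra.of k G g * f.1 j := by
  have hg : D.rep (D.grp g) = D.grpAct g := D.lift_grp _ _ _ _ g
  have hx : D.rep D.x = D.shift := D.lift_x _ _ _ _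
  rw [map_mul, map_pow, hg, hx, Module.End.mul_apply, grpAct_apply, shift_pow_apply, pow_zero,
    one_smul, zero_add]

/-- The sequence that is `1` at `j` and `0` at the other natural numbers below `n`. -/
def deltaSeq (D : RankOneDatum k G) (j : ℕ) : D.seqSpace :=
  ⟨fun i => if i % D.n = j then D.powElt ^ (i / D.n) else 0, fun i => by
    simp only [Nat.add_mod_right, Nat.add_div_right i D.n_pos]
    split_ifs
    · rw [pow_succ']
    · rw [mul_zero]⟩

/-- The coefficient of `g xʲ`, for `j < n`. -/
def coeff (D : RankOneDatum k G) (g : G) (j : ℕ) : D.Alg →ₗ[k] k where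
  toFun s := ((D.rep s (D.deltaSeq j)).1 0).coeff g
  map_add' _ _ := by simp
  map_smul' _ _ := by simp

theorem coeff_grp_mul_x_pow [DecidableEq G] (D : RankOneDatum k G) (g h : G) (i j : ℕ)
    (hi : i < D.n) :
    D.coeff g j (D.grp h * D.x ^ i) = if h = g ∧ i = j then 1 else 0 := by
  change ((D.rep (D.grp h * D.x ^ i) (D.deltaSeq j)).1 0).coeff g = _
  rw [rep_grp_mul_x_pow]
  simp only [deltaSeq, Nat.mod_eq_of_lt hi, Nat.div_eq_of_lt hi, pow_zero]
  by_cases hij : i = j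
  · simp [hij, Finsupp.single_apply]
  · simp [hij]

theorem coeff_grp [DecidableEq G] (D : RankOneDatum k G) (g h : G) (j : ℕ) :
    D.coeff g j (D.grp h) = if h = g ∧ 0 = j then 1 else 0 := by
  simpa using D.coeff_grp_mul_x_pow g h 0 j D.n_pos

theorem coeff_x [DecidableEq G] (D : RankOneDatum k G) (g : G) (j : ℕ) :
    D.coeff g j D.x = if 1 = g ∧ 1 = j then 1 else 0 := by
  simpa using D.coeff_grp_mul_x_pow g 1 1 j D.one_lt_order

theorem grp_injective (D : RankOneDatum k G) : Function.Injective D.grp := by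
  classical
  intro g h e
  have h1 := congrArg (D.coeff g 0) e
  simp only [coeff_grp, and_true, if_true] at h1
  by_contra hne
  rw [if_neg (Ne.symm hne)] at h1
  exact one_ne_zero h1

theorem x_pow_mul_grp (D : RankOneDatum k G) (j : ℕ) (g : G) :
    D.x ^ j * D.grp g = (D.χ g : k) ^ j • (D.grp g * D.x ^ j) := by
  induction j with
  | zero => simp
  | succ j ih =>
    rw [pow_succ', mul_assoc, ih, mul_smul_comm, ← mul_assoc, x_mul_grp, smul_mul_assoc, smul_smul,
      mul_assoc, ← pow_succ]

theorem mono_mul_mono (D : RankOneDatum k G) (g h : G) (i j : ℕ) :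
    D.grp g * D.x ^ i * (D.grp h * D.x ^ j) =
      (D.χ h : k) ^ i • (D.grp (g * h) * D.x ^ (i + j)) := by
  rw [mul_assoc, ← mul_assoc (D.x ^ i), x_pow_mul_grp, smul_mul_assoc, mul_smul_comm, map_mul,
    pow_add]
  simp only [mul_assoc]

/-- The span contains `1` and is stable under left multiplication by the generators, hence by all of
`H`. -/
theorem span_mono (D : RankOneDatum k G) :
    Submodule.span k (Set.range fun m : G × ℕ => D.grp m.1 * D.x ^ m.2) = ⊤ := by
  set S := Submodule.span k (Set.range fun m : G × ℕ => D.grp m.1 * D.x ^ m.2) with hS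
  have hmem : ∀ g j, D.grp g * D.x ^ j ∈ S := fun g j => Submodule.subset_span ⟨(g, j), rfl⟩
  have key : ∀ s : D.Alg, (∀ g j, s * (D.grp g * D.x ^ j) ∈ S) → ∀ t ∈ S, s * t ∈ S := by
    intro s hs t ht
    induction ht using Submodule.span_induction with
    | mem t ht => obtain ⟨m, rfl⟩ := ht; exact hs _ _
    | zero => simp
    | add t t' _ _ h h' => rw [mul_add]; exact S.add_mem h h'
    | smul c t _ h => rw [mul_smul_comm]; exact S.smul_mem _ h
  have main : ∀ s : D.Alg, ∀ t ∈ S, s * t ∈ S := by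
    intro s
    induction s using D.induction with
    | hk c => intro t ht; rw [← Algebra.smul_def]; exact S.smul_mem _ ht
    | hg g => exact key _ fun h j => by rw [← mul_assoc, ← map_mul]; exact hmem _ _
    | hx =>
      refine key _ fun h j => ?_
      rw [← mul_assoc, x_mul_grp, smul_mul_assoc, mul_assoc, ← pow_succ']
      exact S.smul_mem _ (hmem _ _)
    | hadd s t hs ht => intro u hu; rw [add_mul]; exact S.add_mem (hs _ hu) (ht _ hu)
    | hmul s t hs ht => intro u hu; rw [mul_assoc]; exact hs _ (ht _ hu)
  refine Submodule.eq_top_iff'.2 fun s => ?_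
  have h1 : (1 : D.Alg) ∈ S := by simpa using hmem 1 0
  simpa using main s 1 h1

theorem grp_mul_x_pow_add_n (D : RankOneDatum k G) (g : G) (j : ℕ) :
    D.grp g * D.x ^ (j + D.n) =
      D.α • (D.grp (g * D.a ^ D.n) * D.x ^ j) - D.α • (D.grp g * D.x ^ j) := by
  rw [add_comm, pow_add, x_pow, map_mul, map_pow, smul_mul_assoc, mul_smul_comm, ← smul_sub, sub_mul,
    one_mul, mul_sub, mul_assoc]

theorem span_mono_lt (D : RankOneDatum k G) :
    Submodule.span k (Set.range fun m : G × Fin D.n => D.grp m.1 * D.x ^ (m.2 : ℕ)) = ⊤ := by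
  refine eq_top_iff.2 (D.span_mono ▸ Submodule.span_le.2 ?_)
  rintro _ ⟨⟨g, j⟩, rfl⟩
  simp only [SetLike.mem_coe]
  induction j using Nat.strong_induction_on generalizing g with
  | _ j ih =>
    by_cases hj : j < D.n
    · exact Submodule.subset_span ⟨(g, ⟨j, hj⟩), rfl⟩
    · obtain ⟨i, rfl⟩ := Nat.exists_eq_add_of_le' (not_lt.1 hj)
      rw [grp_mul_x_pow_add_n]
      have hi : i < i + D.n := Nat.lt_add_of_pos_right D.n_pos
      exact Submodule.sub_mem _ (Submodule.smul_mem _ _ (ih i hi _))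
        (Submodule.smul_mem _ _ (ih i hi _))

/-- The basis of the monomials `g xʲ` with `j < n`. -/
def monoBasis (D : RankOneDatum k G) : Module.Basis (G × Fin D.n) k D.Alg :=
  Module.Basis.mk (v := fun m : G × Fin D.n => D.grp m.1 * D.x ^ (m.2 : ℕ))
    (by
      classical
      rw [linearIndependent_iff']
      intro s c hc m hm
      have h := congrArg (D.coeff m.1 m.2) hc
      simp only [map_sum, map_smul, map_zero, smul_eq_mul] at h
      rw [Finset.sum_eq_single m] at h
      · simpa [coeff_grp_mul_x_pow] using h
      · intro b _ hb
        rw [D.coeff_grp_mul_x_pow _ _ _ _ b.2.2, if_neg, mul_zero]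
        rintro ⟨h1, h2⟩
        exact hb (Prod.ext h1 (Fin.ext h2))
      · exact fun h' => absurd hm h')
    D.span_mono_lt.ge

theorem monoBasis_apply (D : RankOneDatum k G) (m : G × Fin D.n) :
    D.monoBasis m = D.grp m.1 * D.x ^ (m.2 : ℕ) := by
  simp [monoBasis]

instance [Finite G] (D : RankOneDatum k G) : Module.Finite k D.Alg :=
  Module.Finite.of_basis D.monoBasis

theorem linearMap_ext {M : Type*} [AddCommMonoid M] [Module k M] (D : RankOneDatum k G)
    {f f' : D.Alg →ₗ[k] M} (h : ∀ g j, f (D.grp g * D.x ^ j) = f' (D.grp g * D.x ^ j)) :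
    f = f' :=
  LinearMap.ext_on D.span_mono (by rintro _ ⟨m, rfl⟩; exact h _ _)

theorem linearMap_ext_lt {M : Type*} [AddCommMonoid M] [Module k M] (D : RankOneDatum k G)
    {f f' : D.Alg →ₗ[k] M}
    (h : ∀ g, ∀ j < D.n, f (D.grp g * D.x ^ j) = f' (D.grp g * D.x ^ j)) : f = f' :=
  LinearMap.ext_on D.span_mono_lt (by rintro _ ⟨m, rfl⟩; exact h _ _ m.2.2)

theorem mono_induction (D : RankOneDatum k G) {P : D.Alg → Prop}
    (mono : ∀ g j, P (D.grp g * D.x ^ j)) (add : ∀ s t, P s → P t → P (s + t))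
    (smul : ∀ (c : k) s, P s → P (c • s)) (s : D.Alg) : P s := by
  have hs : s ∈ Submodule.span k (Set.range fun m : G × ℕ => D.grp m.1 * D.x ^ m.2) := by
    rw [span_mono]; trivial
  induction hs using Submodule.span_induction with
  | mem s hs => obtain ⟨m, rfl⟩ := hs; exact mono _ _
  | zero => simpa using smul 0 _ (mono 1 0)
  | add s t _ _ h h' => exact add _ _ h h'
  | smul c s _ h => exact smul _ _ h

theorem sum_coeff [Fintype G] (D : RankOneDatum k G) (s : D.Alg) :
    ∑ g : G, ∑ j ∈ Finset.range D.n, D.coeff g j s • (D.grp g * D.x ^ j) = s := by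
  classical
  have h : (∑ g : G, ∑ j ∈ Finset.range D.n,
      (D.coeff g j).smulRight (D.grp g * D.x ^ j)) = LinearMap.id := by
    refine D.linearMap_ext_lt fun h i hi => ?_
    simp only [LinearMap.sum_apply, LinearMap.smulRight_apply, D.coeff_grp_mul_x_pow _ _ _ _ hi,
      LinearMap.id_apply]
    rw [Finset.sum_eq_single h, Finset.sum_eq_single i]
    · simp
    · intro j _ hj; simp [Ne.symm hj]
    · intro h'; exact absurd (Finset.mem_range.2 hi) h'
    · intro g _ hg; simp [Ne.symm hg]
    · simp
  simpa using LinearMap.congr_fun h s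

/-! ### Comultiplication of monomials -/

/-- The q-binomial theorem applied to `(x ⊗ a + 1 ⊗ x)ᵐ`; it is valid for all `m`, not only `m < n`.
-/
theorem comul_mono (D : RankOneDatum k G) (g : G) (m : ℕ) :
    Coalgebra.comul (R := k) (D.grp g * D.x ^ m) = ∑ r ∈ Finset.range (m + 1),
      (qBinom (D.χ D.a : k) m r • (D.grp g * D.x ^ r)) ⊗ₜ[k]
        (D.grp (g * D.a ^ r) * D.x ^ (m - r)) := by
  rw [comul_eq, map_mul, map_pow, comulHom_grp, comulHom_x, q_add_pow (D.χ D.a : k),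
    Finset.mul_sum]
  · refine Finset.sum_congr rfl fun r _ => ?_
    simp only [Algebra.TensorProduct.tmul_pow, one_pow, Algebra.TensorProduct.tmul_mul_tmul,
      mul_smul_comm, mul_one, map_mul, map_pow, TensorProduct.smul_tmul', mul_assoc]
  · simp [x_mul_grp, TensorProduct.tmul_smul]

/-- The expansion of the comultiplication of `g xᵐ`. -/
def monoRepr (D : RankOneDatum k G) (g : G) (m : ℕ) :
    Coalgebra.Repr k (D.grp g * D.x ^ m) ℕ where
  index := Finset.range (m + 1)
  left r := qBinom (D.χ D.a : k) m r • (D.grp g * D.x ^ r)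
  right r := D.grp (g * D.a ^ r) * D.x ^ (m - r)
  eq := (D.comul_mono g m).symm

theorem comul_grp (D : RankOneDatum k G) (g : G) :
    Coalgebra.comul (R := k) (D.grp g) = D.grp g ⊗ₜ[k] D.grp g := D.comulHom_grp g

theorem comul_x (D : RankOneDatum k G) :
    Coalgebra.comul (R := k) D.x = D.x ⊗ₜ[k] D.grp D.a + 1 ⊗ₜ D.x := D.comulHom_x

theorem counit_grp (D : RankOneDatum k G) (g : G) :
    Coalgebra.counit (R := k) (D.grp g) = 1 := D.counitHom_grp g

theorem counit_mono (D : RankOneDatum k G) (g : G) (m : ℕ) :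
    Coalgebra.counit (R := k) (D.grp g * D.x ^ m) = if m = 0 then 1 else 0 := by
  rw [counit_eq, map_mul, map_pow, counitHom_grp, counitHom_x, one_mul, zero_pow_eq]

end

end RankOneDatum

/-! ### The symmetry between `·` and `:`, and powers of `a` -/

section

variable {G : Type v} [Group G] {dot ddot : G → G → G}

/-- The first and third cycle identities trade places and the second is self-dual, with `v` and `w`
exchanged. -/
theorem IsQBrace.symm (h : IsQBrace dot ddot) : IsQBrace ddot dot where
  left_regular := h.right_regular
  right_regular := h.left_regular
  cycle_one u v w := (h.cycle_three u w v).symm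
  cycle_two u v w := (h.cycle_two u w v).symm
  cycle_three u v w := (h.cycle_one u w v).symm
  dot_one := h.ddot_one
  dot_mul := h.ddot_mul
  ddot_one := h.dot_one
  ddot_mul := h.dot_mul
  mul_dot := h.mul_ddot
  mul_ddot := h.mul_dot

theorem IsQBrace.one_dot (h : IsQBrace dot ddot) (g : G) : dot 1 g = 1 := by
  have e := h.mul_dot 1 1 g
  rw [one_mul, h.ddot_one] at e
  exact left_eq_mul.1 e

end

theorem tensorComul_tmul {k : Type u} {X : Type v} [CommRing k] [AddCommGroup X] [Module k X]
    {Δ₁ Δ₂ : X →ₗ[k] X ⊗[k] X} {ι κ : Type*} {s : Finset ι} {t : Finset κ} {x y : X}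
    {x₁ x₂ : ι → X} {y₁ y₂ : κ → X} (hx : Δ₁ x = ∑ i ∈ s, x₁ i ⊗ₜ[k] x₂ i)
    (hy : Δ₂ y = ∑ j ∈ t, y₁ j ⊗ₜ[k] y₂ j) :
    tensorComul Δ₁ Δ₂ (x ⊗ₜ y) =
      ∑ i ∈ s, ∑ j ∈ t, (x₁ i ⊗ₜ[k] y₁ j) ⊗ₜ[k] (x₂ i ⊗ₜ[k] y₂ j) := by
  simp only [tensorComul, LinearMap.comp_apply, TensorProduct.map_tmul, hx, hy,
    TensorProduct.sum_tmul, TensorProduct.tmul_sum, map_sum, LinearEquiv.coe_coe,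
    TensorProduct.tensorTensorTensorComm_tmul]
  exact Finset.sum_comm

namespace RankOneDatum

noncomputable section

variable {k : Type u} {G : Type v} [Field k] [Group G] {D : RankOneDatum k G}
  {dot ddot : G → G → G} {lam xi : G →* kˣ} {p d : D.Alg →ₗ[k] D.Alg →ₗ[k] D.Alg}

theorem FixesA.symm (h : D.FixesA dot ddot) : D.FixesA ddot dot := fun g =>
  ⟨(h g).2.1, (h g).1, (h g).2.2.2, (h g).2.2.1⟩

theorem CompatibleCharacters.symm (h : D.CompatibleCharacters dot ddot lam xi) :
    D.CompatibleCharacters ddot dot xi lam where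
  one := by rw [h.one, inv_inv]
  two a b := h.four b a
  three a b := (h.three b a).symm
  four a b := h.two b a
  five := h.six
  six := h.five

theorem FixesA.dot_a_pow (hf : D.FixesA dot ddot) (hq : IsQBrace dot ddot) (g : G) (i : ℕ) :
    dot g (D.a ^ i) = g := by
  induction i with
  | zero => rw [pow_zero, hq.dot_one]
  | succ i ih => rw [pow_succ', hq.dot_mul, ih, (hf g).2.2.1]

theorem FixesA.a_pow_dot (hf : D.FixesA dot ddot) (hq : IsQBrace dot ddot) (g : G) (i : ℕ) :
    dot (D.a ^ i) g = D.a ^ i := by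
  induction i with
  | zero => rw [pow_zero, hq.one_dot]
  | succ i ih => rw [pow_succ, hq.mul_dot, (hf g).2.2.2, ih, (hf g).1]

theorem FixesA.dot_mul_a_pow (hf : D.FixesA dot ddot) (hq : IsQBrace dot ddot) (h g : G) (i : ℕ) :
    dot h (g * D.a ^ i) = dot h g := by
  rw [hq.dot_mul, hf.dot_a_pow hq]

theorem FixesA.mul_a_pow_dot (hf : D.FixesA dot ddot) (hq : IsQBrace dot ddot) (h g : G) (i : ℕ) :
    dot (h * D.a ^ i) g = dot h g * D.a ^ i := by
  rw [hq.mul_dot, hf.symm.dot_a_pow hq.symm, hf.a_pow_dot hq]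

/-! ### Operations given on monomials: coalgebra and module axioms -/

theorem GivenBy.mono_grp (hp : D.GivenBy p dot lam) (h g : G) (j : ℕ) :
    p (D.grp h * D.x ^ j) (D.grp g) = (lam g : k) ^ j • (D.grp (dot h g) * D.x ^ j) := by
  simpa using hp h g j 0

theorem GivenBy.apply_mono (hp : D.GivenBy p dot lam) (u : D.Alg) (g : G) {i : ℕ} (hi : i ≠ 0) :
    p u (D.grp g * D.x ^ i) = 0 := by
  have : p.flip (D.grp g * D.x ^ i) = 0 := D.linearMap_ext fun h j => by
    rw [LinearMap.flip_apply, hp, if_neg hi, LinearMap.zero_apply]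
  exact LinearMap.congr_fun this u

/-- Of the terms of `Δ(g xⁱ)` only `g ⊗ g xⁱ` has no `x` in its left leg. -/
theorem sweedler_mono_left {B : D.Alg →ₗ[k] D.Alg →ₗ[k] D.Alg}
    (hB : ∀ g r, r ≠ 0 → ∀ v, B (D.grp g * D.x ^ r) v = 0) (g : G) (i : ℕ) :
    sweedler B (D.grp g * D.x ^ i) = B (D.grp g) (D.grp g * D.x ^ i) := by
  rw [sweedler_eq_sum B _ (D.monoRepr g i)]
  simp only [monoRepr, map_smul, LinearMap.smul_apply]
  rw [Finset.sum_eq_single 0]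
  · simp [qBinom_zero_right]
  · intro r _ hr; rw [hB _ _ hr, smul_zero]
  · simp

/-- Of the terms of `Δ(g xⁱ)` only `g xⁱ ⊗ g aⁱ` has no `x` in its right leg. -/
theorem sweedler_mono_right {B : D.Alg →ₗ[k] D.Alg →ₗ[k] D.Alg}
    (hB : ∀ g r, r ≠ 0 → ∀ u, B u (D.grp g * D.x ^ r) = 0) (g : G) (i : ℕ) :
    sweedler B (D.grp g * D.x ^ i) = B (D.grp g * D.x ^ i) (D.grp (g * D.a ^ i)) := by
  rw [sweedler_eq_sum B _ (D.monoRepr g i)]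
  simp only [monoRepr, map_smul, LinearMap.smul_apply]
  rw [Finset.sum_eq_single i]
  · simp [qBinom_self]
  · intro r hr hri
    have : r < i + 1 := Finset.mem_range.1 hr
    rw [hB _ _ (by omega), smul_zero]
  · simp

/-- Only the term whose right legs are `h aʲ` and `g aⁱ` survives. The powers of `a` contribute
`(ξ(a) λ(a))ⁱʲ`, which is `1` by condition 1. -/
theorem GivenBy.crossMap_mono (hp : D.GivenBy p dot lam) (hd : D.GivenBy d ddot xi)
    (hq : IsQBrace dot ddot) (hf : D.FixesA dot ddot)
    (hc : D.CompatibleCharacters dot ddot lam xi) (h g : G) (j i : ℕ) :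
    crossMap p d ((D.grp h * D.x ^ j) ⊗ₜ (D.grp g * D.x ^ i)) =
      ((xi h : k) ^ i * (lam g : k) ^ j) •
        ((D.grp (ddot g h) * D.x ^ i) ⊗ₜ[k] (D.grp (dot h g) * D.x ^ j)) := by
  rw [crossMap_eq_sum p d _ _ (D.monoRepr h j) (D.monoRepr g i)]
  simp only [monoRepr, map_smul, LinearMap.smul_apply]
  rw [Finset.sum_eq_single j, Finset.sum_eq_single i]
  · have ha : (xi D.a : k) * (lam D.a : k) = 1 := by
      rw [hc.one, ← Units.val_mul, mul_inv_cancel, Units.val_one]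
    simp only [qBinom_self, Nat.sub_self, pow_zero, mul_one, hp.mono_grp, hd.mono_grp,
      hf.dot_mul_a_pow hq, hf.symm.dot_mul_a_pow hq.symm, TensorProduct.smul_tmul',
      TensorProduct.tmul_smul, smul_smul]
    refine congrArg (fun c : k =>
      (c • (D.grp (ddot g h) * D.x ^ i)) ⊗ₜ[k] (D.grp (dot h g) * D.x ^ j)) ?_
    have ha' : (xi D.a : k) ^ (j * i) * (lam D.a : k) ^ (j * i) = 1 := by
      rw [← mul_pow, ha, one_pow]
    simp only [map_mul, map_pow, Units.val_mul, Units.val_pow_eq_pow_val, mul_pow, ← pow_mul]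
    rw [mul_comm i j]
    linear_combination (xi h : k) ^ i * (lam g : k) ^ j * ha'
  · intro r hr hri
    have : r < i + 1 := Finset.mem_range.1 hr
    rw [hp.apply_mono _ _ (by omega), smul_zero, TensorProduct.tmul_zero]
  · simp
  · intro r hr hrj
    have : r < j + 1 := Finset.mem_range.1 hr
    refine Finset.sum_eq_zero fun s _ => ?_
    rw [hd.apply_mono _ _ (by omega), smul_zero, TensorProduct.zero_tmul]
  · simp

theorem tensor_ext {M : Type*} [AddCommMonoid M] [Module k M]
    {f f' : D.Alg ⊗[k] D.Alg →ₗ[k] M}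
    (h : ∀ g j h i, f ((D.grp g * D.x ^ j) ⊗ₜ (D.grp h * D.x ^ i)) =
      f' ((D.grp g * D.x ^ j) ⊗ₜ (D.grp h * D.x ^ i))) : f = f' :=
  TensorProduct.ext <| D.linearMap_ext fun g j => D.linearMap_ext fun h' i => h g j h' i

theorem copComul_mono (g : G) (m : ℕ) :
    copComul k D.Alg (D.grp g * D.x ^ m) = ∑ r ∈ Finset.range (m + 1),
      (D.grp (g * D.a ^ r) * D.x ^ (m - r)) ⊗ₜ[k]
        (qBinom (D.χ D.a : k) m r • (D.grp g * D.x ^ r)) := by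
  simp only [copComul, LinearMap.comp_apply, comul_mono, map_sum, LinearEquiv.coe_coe,
    TensorProduct.comm_tmul]

theorem GivenBy.counit_apply (hp : D.GivenBy p dot lam) (u v : D.Alg) :
    Coalgebra.counit (R := k) (p u v) =
      Coalgebra.counit (R := k) u * Coalgebra.counit (R := k) v := by
  have : p.compr₂ (Coalgebra.counit (R := k) (A := D.Alg)) =
      (LinearMap.mul k k).compl₁₂ (Coalgebra.counit (R := k) (A := D.Alg))
        (Coalgebra.counit (R := k) (A := D.Alg)) := by
    refine D.linearMap_ext fun h j => D.linearMap_ext fun g i => ?_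
    simp only [LinearMap.compr₂_apply, LinearMap.compl₁₂_apply, hp h g j i, counit_mono,
      LinearMap.mul_apply']
    rcases eq_or_ne i 0 with rfl | hi
    · rw [if_pos rfl, map_smul, counit_mono]
      rcases eq_or_ne j 0 with rfl | hj <;> simp [*]
    · simp [hi]
  exact LinearMap.congr_fun₂ this u v

/-- Comultiplicativity holds term by term in the two q-binomial expansions: the binomials agree, and
the extra powers of `λ(a)` and `ξ(a)` cancel. -/
theorem GivenBy.isQMagmaCoalgebra (hp : D.GivenBy p dot lam) (hd : D.GivenBy d ddot xi)
    (hq : IsQBrace dot ddot) (hf : D.FixesA dot ddot)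
    (hc : D.CompatibleCharacters dot ddot lam xi) : IsQMagmaCoalgebra p d where
  counit_dot := hp.counit_apply
  counit_ddot := hd.counit_apply
  counit_cross := by
    apply tensor_ext
    intro h j g i
    simp only [LinearMap.comp_apply, hp.crossMap_mono hd hq hf hc, map_smul,
      TensorProduct.map_tmul, LinearMap.mul'_apply, counit_mono]
    by_cases hi : i = 0 <;> by_cases hj : j = 0 <;> simp [hi, hj]
  comul_cross := by
    apply tensor_ext
    intro h j g i
    rw [LinearMap.comp_apply, LinearMap.comp_apply,
      tensorComul_tmul (D.comul_mono h j) (copComul_mono g i), hp.crossMap_mono hd hq hf hc,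
      map_smul, tensorComul_tmul (copComul_mono _ _) (D.comul_mono _ _), Finset.sum_comm,
      Finset.smul_sum, map_sum]
    refine Finset.sum_congr rfl fun r hr => ?_
    rw [map_sum, Finset.smul_sum]
    refine Finset.sum_congr rfl fun s hs => ?_
    have ha : (xi D.a : k) * (lam D.a : k) = 1 := by
      rw [hc.one, ← Units.val_mul, mul_inv_cancel, Units.val_one]
    have ha' : (xi D.a : k) ^ (s * r) * (lam D.a : k) ^ (s * r) = 1 := by
      rw [← mul_pow, ha, one_pow]
    -- Writing the exponents as `r + r'` and `s + s'` removes the truncated subtractions.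
    obtain ⟨r', rfl⟩ := Nat.exists_eq_add_of_le (Nat.lt_succ_iff.1 (Finset.mem_range.1 hr))
    obtain ⟨s', rfl⟩ := Nat.exists_eq_add_of_le (Nat.lt_succ_iff.1 (Finset.mem_range.1 hs))
    simp only [TensorProduct.map_tmul, ← TensorProduct.smul_tmul', TensorProduct.tmul_smul, map_smul,
      hp.crossMap_mono hd hq hf hc, smul_smul, hf.dot_mul_a_pow hq, hf.mul_a_pow_dot hq,
      hf.symm.dot_mul_a_pow hq.symm, hf.symm.mul_a_pow_dot hq.symm, Nat.add_sub_cancel_left]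
    refine congrArg (fun c : k => c • (((D.grp (ddot g h * D.a ^ r) * D.x ^ r') ⊗ₜ[k]
      (D.grp (dot h g) * D.x ^ s)) ⊗ₜ[k] ((D.grp (ddot g h) * D.x ^ r) ⊗ₜ[k]
        (D.grp (dot h g * D.a ^ s) * D.x ^ s')))) ?_
    simp only [map_mul, map_pow, Units.val_mul, Units.val_pow_eq_pow_val, mul_pow, ← pow_mul]
    rw [mul_comm r s]
    linear_combination (xi h : k) ^ (r + r') * (lam g : k) ^ (s + s') *
      qBinom (D.χ D.a : k) (s + s') s * qBinom (D.χ D.a : k) (r + r') r * ha'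

theorem GivenBy.apply_one (hp : D.GivenBy p dot lam) (h1 : ∀ g, dot g 1 = g) (u : D.Alg) :
    p u 1 = u := by
  have : p.flip 1 = LinearMap.id := D.linearMap_ext fun h j => by
    rw [← map_one D.grp, LinearMap.flip_apply, hp.mono_grp, h1]
    simp
  exact LinearMap.congr_fun this u

theorem GivenBy.apply_mul (hp : D.GivenBy p dot lam)
    (hm : ∀ g h l, dot g (h * l) = dot (dot g l) h) (u v w : D.Alg) :
    p u (v * w) = p (p u w) v := by
  induction u using D.mono_induction with
  | add s t hs ht => simp only [map_add, LinearMap.add_apply, hs, ht]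
  | smul c s hs => simp only [map_smul, LinearMap.smul_apply, hs]
  | mono h j =>
  induction v using D.mono_induction with
  | add s t hs ht => simp only [map_add, add_mul, hs, ht]
  | smul c s hs => simp only [map_smul, smul_mul_assoc, hs]
  | mono g i =>
  induction w using D.mono_induction with
  | add s t hs ht => simp only [map_add, LinearMap.add_apply, mul_add, hs, ht]
  | smul c s hs => simp only [map_smul, LinearMap.smul_apply, mul_smul_comm, hs]
  | mono l m =>
  rw [mono_mul_mono, map_smul]
  rcases eq_or_ne m 0 with rfl | hm0
  · rcases eq_or_ne i 0 with rfl | hi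
    · simp only [pow_zero, mul_one, one_mul, add_zero, hp.mono_grp, map_smul,
        LinearMap.smul_apply, smul_smul, hm, map_mul lam, Units.val_mul, mul_pow,
        mul_comm ((lam g : k) ^ j)]
    · rw [hp.apply_mono _ _ hi, hp.apply_mono _ _ (by omega), smul_zero]
  · rw [hp.apply_mono _ _ (by omega), hp.apply_mono _ _ hm0, map_zero, LinearMap.zero_apply,
      smul_zero]

end

end RankOneDatum

/-! ### Sweedler sums as compositions of linear maps -/

section

variable {k : Type u} {X : Type v} [CommRing k] [AddCommGroup X] [Module k X]

theorem gMap_tmul {Δ : X →ₗ[k] X ⊗[k] X} (p : X →ₗ[k] X →ₗ[k] X) {ι : Type*} {s : Finset ι}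
    {y : X} {y₁ y₂ : ι → X} (hy : Δ y = ∑ i ∈ s, y₁ i ⊗ₜ[k] y₂ i) (x : X) :
    gMap Δ p (x ⊗ₜ y) = ∑ i ∈ s, p x (y₁ i) ⊗ₜ[k] y₂ i := by
  simp [gMap, hy, TensorProduct.tmul_sum]

variable [Coalgebra k X]

/-- This form makes the linearity in `f` and `g` visible, so that identities can be checked on
monomials. -/
theorem sweedler_compl₁₂ (B : X →ₗ[k] X →ₗ[k] X) (f g : X →ₗ[k] X) (v : X) :
    sweedler (B.compl₁₂ f g) v =
      TensorProduct.lift B (TensorProduct.map f g (Coalgebra.comul v)) := by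
  have h : TensorProduct.lift (B.compl₁₂ f g) =
      TensorProduct.lift B ∘ₗ TensorProduct.map f g := by
    ext; simp
  rw [sweedler, h]
  rfl

theorem sweedler_compl₁₂_flip (B : X →ₗ[k] X →ₗ[k] X) (f g : X →ₗ[k] X) (v : X) :
    sweedler (B.compl₁₂ f g).flip v =
      TensorProduct.lift B (TensorProduct.map f g (copComul k X v)) := by
  have h : TensorProduct.lift (B.compl₁₂ f g).flip =
      TensorProduct.lift B ∘ₗ TensorProduct.map f g ∘ₗ
        (TensorProduct.comm k X X).toLinearMap := by
    ext; simp
  rw [sweedler, h]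
  rfl

end

/-! ### Operations given on monomials: cycle identities, products, regularity -/

namespace RankOneDatum

noncomputable section

variable {k : Type u} {G : Type v} [Field k] [Group G] {D : RankOneDatum k G}
  {dot ddot : G → G → G} {lam xi : G →* kˣ} {p d : D.Alg →ₗ[k] D.Alg →ₗ[k] D.Alg}

/-- A common template for the three cycle identities. If `v` or `w` contains `x`, both sides vanish;
for `v, w ∈ G` and `u = h xʲ`, the scalars are the `j`-th powers of those in `hc`. -/
theorem sweedler_eq_of_givenBy {q r s q' r' s' : D.Alg →ₗ[k] D.Alg →ₗ[k] D.Alg}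
    {dq dr ds dq' dr' ds' : G → G → G} {cq cr cs cq' cr' cs' : G →* kˣ}
    (hq : D.GivenBy q dq cq) (hr : D.GivenBy r dr cr) (hs : D.GivenBy s ds cs)
    (hq' : D.GivenBy q' dq' cq') (hr' : D.GivenBy r' dr' cr') (hs' : D.GivenBy s' ds' cs')
    (hG : ∀ u v w, dq (dr u v) (ds w v) = dq' (dr' u w) (ds' v w))
    (hc : ∀ v w, cr v * cq (ds w v) = cr' w * cq' (ds' v w)) (u v w : D.Alg) :
    sweedler (q.compl₁₂ (r u) (s w)) v = sweedler (q'.compl₁₂ (r' u) (s' v)).flip w := by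
  induction u using D.mono_induction with
  | add a b ha hb =>
    simp only [sweedler_compl₁₂, sweedler_compl₁₂_flip, map_add, TensorProduct.map_add_left,
      LinearMap.add_apply] at ha hb ⊢
    rw [ha, hb]
  | smul c a ha =>
    simp only [sweedler_compl₁₂, sweedler_compl₁₂_flip, map_smul, TensorProduct.map_smul_left,
      LinearMap.smul_apply] at ha ⊢
    rw [ha]
  | mono h j =>
  induction v using D.mono_induction with
  | add a b ha hb =>
    simp only [sweedler_compl₁₂, sweedler_compl₁₂_flip, map_add, TensorProduct.map_add_right,
      LinearMap.add_apply] at ha hb ⊢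
    rw [ha, hb]
  | smul c a ha =>
    simp only [sweedler_compl₁₂, sweedler_compl₁₂_flip, map_smul, TensorProduct.map_smul_right,
      LinearMap.smul_apply] at ha ⊢
    rw [ha]
  | mono g i =>
  induction w using D.mono_induction with
  | add a b ha hb =>
    simp only [sweedler_compl₁₂, sweedler_compl₁₂_flip, map_add, TensorProduct.map_add_right,
      LinearMap.add_apply] at ha hb ⊢
    rw [ha, hb]
  | smul c a ha =>
    simp only [sweedler_compl₁₂, sweedler_compl₁₂_flip, map_smul, TensorProduct.map_smul_right,
      LinearMap.smul_apply] at ha ⊢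
    rw [ha]
  | mono l m =>
  rw [sweedler_mono_left, sweedler_mono_right]
  · simp only [LinearMap.flip_apply, LinearMap.compl₁₂_apply]
    rcases eq_or_ne m 0 with rfl | hm
    · rcases eq_or_ne i 0 with rfl | hi
      · have e := congrArg (fun z : kˣ => (z : k) ^ j) (hc g l)
        simp only [Units.val_mul, mul_pow] at e
        simp only [pow_zero, mul_one, hr.mono_grp, hr'.mono_grp, map_smul, LinearMap.smul_apply]
        have h1 : s (D.grp l) (D.grp g) = D.grp (ds l g) := by simpa using hs.mono_grp l g 0
        have h2 : s' (D.grp g) (D.grp l) = D.grp (ds' g l) := by simpa using hs'.mono_grp g l 0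
        rw [h1, h2, hq.mono_grp, hq'.mono_grp, smul_smul, smul_smul, hG, e]
      · simp only [pow_zero, mul_one]
        rw [hs.apply_mono _ _ hi, map_zero, hs'.mono_grp, map_smul, hq'.apply_mono _ _ hi,
          smul_zero]
    · rw [hs'.apply_mono _ _ hm, map_zero]
      rcases eq_or_ne i 0 with rfl | hi
      · rw [pow_zero, mul_one, hs.mono_grp, map_smul, hq.apply_mono _ _ hm, smul_zero]
      · rw [hs.apply_mono _ _ hi, map_zero]
  · intro g' r₀ hr₀ u'
    simp only [LinearMap.flip_apply, LinearMap.compl₁₂_apply]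
    rw [hr'.apply_mono _ _ hr₀, map_zero, LinearMap.zero_apply]
  · intro g' r₀ hr₀ v'
    simp only [LinearMap.compl₁₂_apply]
    rw [hr.apply_mono _ _ hr₀, map_zero, LinearMap.zero_apply]

/-- For `u = h xʲ`, `v = g xⁱ` and `w = l`, moving `xʲ` past `g` before or after the action of `l`
gives scalars that agree by the `j`-th power of condition 5. -/
theorem GivenBy.mul_apply (hp : D.GivenBy p dot lam) (hd : D.GivenBy d ddot xi)
    (hq : IsQBrace dot ddot) (hf : D.FixesA dot ddot)
    (hc : D.CompatibleCharacters dot ddot lam xi) (u v w : D.Alg) :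
    p (u * v) w = LinearMap.mul' k D.Alg (LinearMap.rTensor D.Alg (p u)
      (crossMap p d (v ⊗ₜ w))) := by
  induction u using D.mono_induction with
  | add a b ha hb =>
    simp only [add_mul, map_add, LinearMap.add_apply, LinearMap.rTensor_add, ha, hb]
  | smul c a ha =>
    simp only [smul_mul_assoc, map_smul, LinearMap.smul_apply, LinearMap.rTensor_smul, ha]
  | mono h j =>
  induction v using D.mono_induction with
  | add a b ha hb =>
    simp only [mul_add, map_add, LinearMap.add_apply, TensorProduct.add_tmul, ha, hb]
  | smul c a ha =>
    simp only [mul_smul_comm, map_smul, LinearMap.smul_apply, ← TensorProduct.smul_tmul', ha]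
  | mono g i =>
  induction w using D.mono_induction with
  | add a b ha hb => simp only [map_add, TensorProduct.tmul_add, ha, hb]
  | smul c a ha => simp only [map_smul, TensorProduct.tmul_smul, ha]
  | mono l m =>
  rw [hp.crossMap_mono hd hq hf hc, mono_mul_mono, map_smul, LinearMap.smul_apply, map_smul,
    map_smul, LinearMap.rTensor_tmul, LinearMap.mul'_apply]
  rcases eq_or_ne m 0 with rfl | hm
  · simp only [pow_zero, mul_one, one_mul, hp.mono_grp, smul_mul_assoc, mono_mul_mono, smul_smul,
      hq.mul_dot]
    have e := congrArg (fun z : kˣ => (z : k) ^ j) (hc.five g l)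
    simp only [Units.val_mul, mul_pow] at e
    refine congrArg (fun c : k => c • (D.grp (dot h (ddot l g) * dot g l) * D.x ^ (j + i))) ?_
    linear_combination (lam l : k) ^ i * e
  · rw [hp.apply_mono _ _ hm, hp.apply_mono _ _ hm, zero_mul, smul_zero, smul_zero]

/-- The map leaves the second factor `g xⁱ` alone and acts on the first by `τ g i`, so it reaches
every pair of monomials; in finite dimension this suffices. The function `τ` covers both regularity
conditions. -/
theorem GivenBy.bijective_gMap [Finite G] (hp : D.GivenBy p dot lam)
    (hd : ∀ g, Function.Surjective fun h => dot h g) {Δ : D.Alg →ₗ[k] D.Alg ⊗[k] D.Alg}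
    (τ : G → ℕ → G) (hΔ : ∀ u g i, gMap Δ p (u ⊗ₜ (D.grp g * D.x ^ i)) =
      p u (D.grp (τ g i)) ⊗ₜ (D.grp g * D.x ^ i)) :
    Function.Bijective (gMap Δ p) := by
  have hs : Function.Surjective (gMap Δ p) := by
    -- Surjectivity becomes the vanishing of the quotient map by the range, which can be tested on
    -- monomials.
    rw [← LinearMap.range_eq_top, ← (LinearMap.range (gMap Δ p)).ker_mkQ, LinearMap.ker_eq_top]
    apply tensor_ext
    intro h j g i
    rw [LinearMap.zero_apply, Submodule.mkQ_apply, Submodule.Quotient.mk_eq_zero]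
    obtain ⟨h', hh⟩ := hd (τ g i) h
    refine ⟨(((lam (τ g i))⁻¹ : kˣ) : k) ^ j • (D.grp h' * D.x ^ j) ⊗ₜ (D.grp g * D.x ^ i), ?_⟩
    rw [map_smul, hΔ, hp.mono_grp, ← TensorProduct.smul_tmul', smul_smul, ← mul_pow, ← Units.val_mul,
      inv_mul_cancel, Units.val_one, one_pow, one_smul]
    exact congrArg (fun z => (D.grp z * D.x ^ j) ⊗ₜ[k] (D.grp g * D.x ^ i)) hh
  exact ⟨LinearMap.injective_iff_surjective.2 hs, hs⟩

theorem GivenBy.gMap_comul (hp : D.GivenBy p dot lam) (u : D.Alg) (g : G) (i : ℕ) :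
    gMap Coalgebra.comul p (u ⊗ₜ (D.grp g * D.x ^ i)) =
      p u (D.grp g) ⊗ₜ (D.grp g * D.x ^ i) := by
  rw [gMap_tmul p (D.comul_mono g i), Finset.sum_eq_single 0]
  · simp [qBinom_zero_right]
  · intro r _ hr
    rw [map_smul, hp.apply_mono _ _ hr, smul_zero, TensorProduct.zero_tmul]
  · simp

theorem GivenBy.gMap_copComul (hp : D.GivenBy p dot lam) (u : D.Alg) (g : G) (i : ℕ) :
    gMap (copComul k D.Alg) p (u ⊗ₜ (D.grp g * D.x ^ i)) =
      p u (D.grp (g * D.a ^ i)) ⊗ₜ (D.grp g * D.x ^ i) := by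
  rw [gMap_tmul p (copComul_mono g i), Finset.sum_eq_single i]
  · simp [qBinom_self]
  · intro r hr hri
    have : r < i + 1 := Finset.mem_range.1 hr
    rw [hp.apply_mono _ _ (by omega), TensorProduct.zero_tmul]
  · simp

theorem GivenBy.isHopfQBrace [Finite G] (hp : D.GivenBy p dot lam) (hd : D.GivenBy d ddot xi)
    (hq : IsQBrace dot ddot) (hf : D.FixesA dot ddot)
    (hc : D.CompatibleCharacters dot ddot lam xi) : IsHopfQBrace p d where
  toIsQMagmaCoalgebra := hp.isQMagmaCoalgebra hd hq hf hc
  left_regular := hp.bijective_gMap (fun g => (hq.left_regular g).2) (fun g _ => g) hp.gMap_comul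
  right_regular :=
    hd.bijective_gMap (fun g => (hq.right_regular g).2) (fun g i => g * D.a ^ i) hd.gMap_copComul
  cycle_one := sweedler_eq_of_givenBy hp hp hd hp hp hp hq.cycle_one
    fun v w => by simpa only [map_mul] using hc.two v w
  cycle_two := sweedler_eq_of_givenBy hd hp hp hp hd hd hq.cycle_two
    fun v w => hc.three v w
  cycle_three := sweedler_eq_of_givenBy hd hd hd hd hd hp hq.cycle_three
    fun v w => by simpa only [map_mul] using (hc.four v w).symm
  dot_one := hp.apply_one hq.dot_one
  dot_mul := hp.apply_mul hq.dot_mul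
  ddot_one := hd.apply_one hq.ddot_one
  ddot_mul := hd.apply_mul hq.ddot_mul
  mul_dot := hp.mul_apply hd hq hf hc
  mul_ddot := hd.mul_apply hp hq.symm hf.symm hc.symm

/-! ### Existence and uniqueness of the operations -/

theorem GivenBy.unique {p' : D.Alg →ₗ[k] D.Alg →ₗ[k] D.Alg} (hp : D.GivenBy p dot lam)
    (hp' : D.GivenBy p' dot lam) : p = p' :=
  D.linearMap_ext fun h j => D.linearMap_ext fun g i => by rw [hp, hp']

/-- Evaluate `xⁿ · g` twice: as a monomial it is scaled by `λ(g)ⁿ`, while as `α(aⁿ - 1)` it is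
fixed, since `aⁿ · g = aⁿ` and `1 · g = 1`. -/
theorem GivenBy.pow_smul (hp : D.GivenBy p dot lam) (hq : IsQBrace dot ddot)
    (hf : D.FixesA dot ddot) (g : G) :
    (lam g : k) ^ D.n • (D.α • (D.grp D.a ^ D.n - 1)) = D.α • (D.grp D.a ^ D.n - 1) := by
  have h := hp.mono_grp 1 g D.n
  have h1 : ∀ h, p (D.grp h) (D.grp g) = D.grp (dot h g) := fun h => by
    simpa using hp.mono_grp h g 0
  rw [hq.one_dot, map_one, one_mul, x_pow, map_smul, LinearMap.smul_apply, map_sub,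
    LinearMap.sub_apply, ← map_pow, h1, hf.a_pow_dot hq, ← map_one D.grp, h1, hq.one_dot,
    map_one] at h
  rw [← map_pow]
  exact h.symm

theorem pow_eq_one_of_smul {C : D.Alg} (hC : C ≠ 0) {l : G →* kˣ}
    (h : ∀ g, (l g : k) ^ D.n • C = C) : l ^ D.n = 1 := by
  ext g
  have := h g
  rw [← sub_eq_zero] at this
  nth_rw 2 [← one_smul k C] at this
  rw [← sub_smul] at this
  have := sub_eq_zero.1 ((smul_eq_zero.1 this).resolve_right hC)
  simpa using this

/-- The action of `g` on `H_D` by `h xʲ ↦ lam(g)ʲ (h · g) xʲ`, for `j < n`. -/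
def actBy (D : RankOneDatum k G) (dot : G → G → G) (lam : G →* kˣ) (g : G) :
    D.Alg →ₗ[k] D.Alg :=
  D.monoBasis.constr k fun m => (lam g : k) ^ (m.2 : ℕ) • (D.grp (dot m.1 g) * D.x ^ (m.2 : ℕ))

/-- The bilinear operation on `H_D` given by `dot` and `lam` on the monomial basis. -/
def opBy (D : RankOneDatum k G) (dot : G → G → G) (lam : G →* kˣ) :
    D.Alg →ₗ[k] D.Alg →ₗ[k] D.Alg :=
  LinearMap.flip <| D.monoBasis.constr k fun m => if (m.2 : ℕ) = 0 then D.actBy dot lam m.1 else 0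

/-- For `j < n` this is the construction. Beyond that, reduce by `xⁿ = α(aⁿ - 1)`; the formula
survives because `hl` lets `xⁿ` absorb `λ(g)ⁿ`. -/
theorem actBy_apply (hq : IsQBrace dot ddot) (hf : D.FixesA dot ddot) (g : G)
    (hl : (lam g : k) ^ D.n • (D.α • (D.grp D.a ^ D.n - 1)) = D.α • (D.grp D.a ^ D.n - 1))
    (h : G) (j : ℕ) :
    D.actBy dot lam g (D.grp h * D.x ^ j) = (lam g : k) ^ j • (D.grp (dot h g) * D.x ^ j) := by
  induction j using Nat.strong_induction_on generalizing h with
  | _ j ih =>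
    by_cases hj : j < D.n
    · have := D.monoBasis.constr_basis k (fun m : G × Fin D.n =>
        (lam g : k) ^ (m.2 : ℕ) • (D.grp (dot m.1 g) * D.x ^ (m.2 : ℕ))) (h, ⟨j, hj⟩)
      rwa [monoBasis_apply] at this
    · obtain ⟨i, rfl⟩ := Nat.exists_eq_add_of_le' (not_lt.1 hj)
      have hi : i < i + D.n := Nat.lt_add_of_pos_right D.n_pos
      have e : (lam g : k) ^ D.n • (D.grp (dot h g) * D.x ^ (i + D.n)) =
          D.grp (dot h g) * D.x ^ (i + D.n) := by
        rw [add_comm, pow_add, ← mul_smul_comm, ← smul_mul_assoc, x_pow, hl]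
      rw [grp_mul_x_pow_add_n, map_sub, map_smul, map_smul, ih i hi, ih i hi,
        hf.mul_a_pow_dot hq, pow_add, mul_smul, e, grp_mul_x_pow_add_n, smul_sub,
        smul_comm D.α, smul_comm D.α]

theorem opBy_givenBy (hq : IsQBrace dot ddot) (hf : D.FixesA dot ddot)
    (h : D.α • (D.grp D.a ^ D.n - 1) = 0 ∨ lam ^ D.n = 1) :
    D.GivenBy (D.opBy dot lam) dot lam := by
  have hl : ∀ g, (lam g : k) ^ D.n • (D.α • (D.grp D.a ^ D.n - 1)) =
      D.α • (D.grp D.a ^ D.n - 1) := by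
    intro g
    rcases h with h | h
    · rw [h, smul_zero]
    · have : lam g ^ D.n = 1 := DFunLike.congr_fun h g
      rw [← Units.val_pow_eq_pow_val, this, Units.val_one, one_smul]
  -- The relation must also be respected in the second variable: `g xⁿ` has to act as `0`, although
  -- it equals `α(g aⁿ - g)`.
  have hact : ∀ g, D.α • D.actBy dot lam (g * D.a ^ D.n) - D.α • D.actBy dot lam g = 0 := by
    intro g
    refine D.linearMap_ext fun h' j => ?_
    rw [LinearMap.sub_apply, LinearMap.smul_apply, LinearMap.smul_apply,
      actBy_apply hq hf _ (hl _), actBy_apply hq hf _ (hl _), hf.dot_mul_a_pow hq,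
      LinearMap.zero_apply]
    -- If `α(aⁿ - 1)` vanishes in `H` and `α ≠ 0`, then `aⁿ = 1` already in `G`, as `G` embeds in
    -- `H`.
    have hz : D.α = 0 ∨ lam (D.a ^ D.n) = 1 := by
      rcases h with h | h
      · refine (smul_eq_zero.1 h).imp_right fun h => ?_
        rw [← map_pow, sub_eq_zero, ← map_one D.grp] at h
        rw [D.grp_injective h, map_one]
      · right
        rw [map_pow]
        exact DFunLike.congr_fun h D.a
    rcases hz with hz | hz
    · rw [hz, zero_smul, zero_smul, sub_self]
    · rw [map_mul, hz, mul_one, sub_self]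
  intro h' g j i
  have key : ∀ i g, (D.opBy dot lam).flip (D.grp g * D.x ^ i) =
      if i = 0 then D.actBy dot lam g else 0 := by
    intro i
    induction i using Nat.strong_induction_on with
    | _ i ih =>
      intro g
      by_cases hi : i < D.n
      · have := D.monoBasis.constr_basis k (fun m : G × Fin D.n =>
          if (m.2 : ℕ) = 0 then D.actBy dot lam m.1 else 0) (g, ⟨i, hi⟩)
        rwa [monoBasis_apply] at this
      · obtain ⟨r, rfl⟩ := Nat.exists_eq_add_of_le' (not_lt.1 hi)
        have hr : r < r + D.n := Nat.lt_add_of_pos_right D.n_pos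
        have hn := D.n_pos
        rw [grp_mul_x_pow_add_n, map_sub, map_smul, map_smul, ih r hr, ih r hr,
          if_neg (c := r + D.n = 0) (by omega)]
        split_ifs
        · exact hact g
        · simp
  have := LinearMap.congr_fun (key i g) (D.grp h' * D.x ^ j)
  rw [LinearMap.flip_apply] at this
  rw [this]
  split_ifs
  · exact actBy_apply hq hf g (hl g) h' j
  · rfl

/-- Uniqueness is automatic because the monomials span, so only existence depends on the condition.
-/
theorem existsUnique_givenBy_iff (hq : IsQBrace dot ddot) (hf : D.FixesA dot ddot) :
    (∃! pd : (D.Alg →ₗ[k] D.Alg →ₗ[k] D.Alg) × (D.Alg →ₗ[k] D.Alg →ₗ[k] D.Alg),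
        D.GivenBy pd.1 dot lam ∧ D.GivenBy pd.2 ddot xi) ↔
      (D.α • (D.grp D.a ^ D.n - 1) = 0 ∨ (lam ^ D.n = 1 ∧ xi ^ D.n = 1)) := by
  constructor
  · rintro ⟨pd, ⟨hp, hd⟩, -⟩
    refine or_iff_not_imp_left.2 fun hC => ?_
    exact ⟨pow_eq_one_of_smul hC (hp.pow_smul hq hf),
      pow_eq_one_of_smul hC (hd.pow_smul hq.symm hf.symm)⟩
  · intro h
    refine ⟨(D.opBy dot lam, D.opBy ddot xi),
      ⟨opBy_givenBy hq hf (h.imp_right And.left),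
        opBy_givenBy hq.symm hf.symm (h.imp_right And.right)⟩, ?_⟩
    rintro ⟨p, d⟩ ⟨hp, hd⟩
    exact Prod.ext (hp.unique (opBy_givenBy hq hf (h.imp_right And.left)))
      (hd.unique (opBy_givenBy hq.symm hf.symm (h.imp_right And.right)))

end

end RankOneDatum

/-! ### Consequences of the q-magma axioms over a general coalgebra -/

section

variable {k : Type u} {X : Type v} [CommRing k] [AddCommGroup X] [Module k X]

theorem tensorComul_comm (Δ₁ Δ₂ : X →ₗ[k] X ⊗[k] X) (z : X ⊗[k] X) :
    TensorProduct.map (TensorProduct.comm k X X).toLinearMap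
      (TensorProduct.comm k X X).toLinearMap (tensorComul Δ₁ Δ₂ z) =
    tensorComul Δ₂ Δ₁ (TensorProduct.comm k X X z) := by
  induction z with
  | zero => simp
  | add z z' hz hz' => simp only [map_add, hz, hz']
  | tmul x y =>
  simp only [tensorComul, LinearMap.comp_apply, LinearEquiv.coe_coe, TensorProduct.comm_tmul,
    TensorProduct.map_tmul]
  generalize Δ₁ x = s
  generalize Δ₂ y = t
  induction s with
  | zero => simp
  | add s s' hs hs' => simp only [TensorProduct.add_tmul, TensorProduct.tmul_add, map_add, hs, hs']
  | tmul s s' =>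
    induction t with
    | zero => simp
    | add t t' ht ht' =>
      simp only [TensorProduct.add_tmul, TensorProduct.tmul_add, map_add, ht, ht']
    | tmul t t' => simp

theorem tensorComul_comm_comp (Δ₁ Δ₂ : X →ₗ[k] X ⊗[k] X) (z : X ⊗[k] X) :
    tensorComul ((TensorProduct.comm k X X).toLinearMap ∘ₗ Δ₁)
      ((TensorProduct.comm k X X).toLinearMap ∘ₗ Δ₂) z =
    TensorProduct.comm k (X ⊗[k] X) (X ⊗[k] X) (tensorComul Δ₁ Δ₂ z) := by
  induction z with
  | zero => simp
  | add z z' hz hz' => simp only [map_add, hz, hz']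
  | tmul x y =>
  simp only [tensorComul, LinearMap.comp_apply, LinearEquiv.coe_coe, TensorProduct.map_tmul]
  generalize Δ₁ x = s
  generalize Δ₂ y = t
  induction s with
  | zero => simp
  | add s s' hs hs' => simp only [TensorProduct.add_tmul, map_add, hs, hs']
  | tmul s s' =>
    induction t with
    | zero => simp
    | add t t' ht ht' => simp only [TensorProduct.tmul_add, map_add, ht, ht']
    | tmul t t' => simp

variable [Coalgebra k X]

theorem sum_counit_right_smul {ι : Type*} {x : X} (r : Coalgebra.Repr k x ι) :
    ∑ i ∈ r.index, Coalgebra.counit (R := k) (r.right i) • r.left i = x := by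
  have h := congrArg (TensorProduct.rid k X) (Coalgebra.sum_tmul_counit_eq r)
  simpa only [map_sum, TensorProduct.rid_tmul, one_smul] using h

theorem comul_eq_sum {ι : Type*} {x : X} (r : Coalgebra.Repr k x ι) :
    Coalgebra.comul (R := k) x = ∑ i ∈ r.index, r.left i ⊗ₜ[k] r.right i := r.eq.symm

theorem copComul_eq_sum {ι : Type*} {x : X} (r : Coalgebra.Repr k x ι) :
    copComul k X x = ∑ i ∈ r.index, r.right i ⊗ₜ[k] r.left i := by
  simp [copComul, ← r.eq]

variable (k X) in
/-- The map `x ⊗ y ↦ ε(x) y`. -/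
def counitLeft : X ⊗[k] X →ₗ[k] X :=
  (TensorProduct.lid k X).toLinearMap ∘ₗ LinearMap.rTensor X Coalgebra.counit

variable (k X) in
/-- The map `x ⊗ y ↦ ε(y) x`. -/
def counitRight : X ⊗[k] X →ₗ[k] X :=
  (TensorProduct.rid k X).toLinearMap ∘ₗ LinearMap.lTensor X Coalgebra.counit

theorem counitLeft_tmul (x y : X) :
    counitLeft k X (x ⊗ₜ y) = Coalgebra.counit (R := k) x • y := by simp [counitLeft]

theorem counitRight_tmul (x y : X) :
    counitRight k X (x ⊗ₜ y) = Coalgebra.counit (R := k) y • x := by simp [counitRight]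

theorem crossMap_swap (p d : X →ₗ[k] X →ₗ[k] X) :
    crossMap d p = (TensorProduct.comm k X X).toLinearMap ∘ₗ crossMap p d ∘ₗ
      (TensorProduct.comm k X X).toLinearMap := by
  refine TensorProduct.ext' fun x y => ?_
  have r := Coalgebra.Repr.arbitrary k x
  have s := Coalgebra.Repr.arbitrary k y
  simp only [LinearMap.comp_apply, LinearEquiv.coe_coe, TensorProduct.comm_tmul,
    crossMap_eq_sum _ _ _ _ r s, crossMap_eq_sum _ _ _ _ s r, map_sum]
  exact Finset.sum_comm

namespace IsQMagmaCoalgebra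

variable {p d : X →ₗ[k] X →ₗ[k] X}

/-- Applying `ε` to `y₍₁₎ : x₍₂₎` leaves `x · y`; the cross map thus determines each operation. -/
theorem counitLeft_crossMap (h : IsQMagmaCoalgebra p d) :
    counitLeft k X ∘ₗ crossMap p d = TensorProduct.lift p := by
  refine TensorProduct.ext' fun x y => ?_
  have r := Coalgebra.Repr.arbitrary k x
  have s := Coalgebra.Repr.arbitrary k y
  have e : p x y = p (∑ i ∈ r.index, Coalgebra.counit (R := k) (r.right i) • r.left i)
      (∑ j ∈ s.index, Coalgebra.counit (R := k) (s.left j) • s.right j) := by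
    rw [sum_counit_right_smul, Coalgebra.sum_counit_smul]
  rw [TensorProduct.lift.tmul, e]
  simp only [LinearMap.comp_apply, crossMap_eq_sum _ _ _ _ r s, map_sum, counitLeft_tmul,
    h.counit_ddot, map_smul, LinearMap.sum_apply, LinearMap.smul_apply, smul_smul,
    Finset.smul_sum]
  rw [Finset.sum_comm]

theorem counitRight_crossMap (h : IsQMagmaCoalgebra p d) :
    counitRight k X ∘ₗ crossMap p d = TensorProduct.lift d.flip := by
  refine TensorProduct.ext' fun x y => ?_
  have r := Coalgebra.Repr.arbitrary k x
  have s := Coalgebra.Repr.arbitrary k y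
  have e : d y x = d (∑ j ∈ s.index, Coalgebra.counit (R := k) (s.right j) • s.left j)
      (∑ i ∈ r.index, Coalgebra.counit (R := k) (r.left i) • r.right i) := by
    rw [sum_counit_right_smul, Coalgebra.sum_counit_smul]
  rw [TensorProduct.lift.tmul, LinearMap.flip_apply, e]
  simp only [LinearMap.comp_apply, crossMap_eq_sum _ _ _ _ r s, map_sum, counitRight_tmul,
    h.counit_dot, map_smul, LinearMap.sum_apply, LinearMap.smul_apply, smul_smul,
    Finset.smul_sum]

/-- Projecting both copies of the comultiplicativity of the cross map to their second factors gives
`Δ(x · y) = x₍₁₎ · y₍₂₎ ⊗ x₍₂₎ · y₍₁₎`. -/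
theorem comul_dot (h : IsQMagmaCoalgebra p d) :
    Coalgebra.comul ∘ₗ TensorProduct.lift p =
    TensorProduct.map (TensorProduct.lift p) (TensorProduct.lift p) ∘ₗ
      tensorComul Coalgebra.comul (copComul k X) := by
  have e : TensorProduct.map (counitLeft k X) (counitLeft k X) ∘ₗ
      tensorComul (copComul k X) Coalgebra.comul = Coalgebra.comul ∘ₗ counitLeft k X := by
    refine TensorProduct.ext' fun x y => ?_
    have r := Coalgebra.Repr.arbitrary k x
    have s := Coalgebra.Repr.arbitrary k y
    have ex : Coalgebra.counit (R := k) x = ∑ i ∈ r.index,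
        Coalgebra.counit (R := k) (r.right i) * Coalgebra.counit (R := k) (r.left i) := by
      conv_lhs => rw [← sum_counit_right_smul r]
      simp
    rw [LinearMap.comp_apply, LinearMap.comp_apply,
      tensorComul_tmul (copComul_eq_sum r) (comul_eq_sum s), counitLeft_tmul, map_smul, ex,
      comul_eq_sum s]
    simp only [map_sum, TensorProduct.map_tmul, counitLeft_tmul, Finset.sum_smul, Finset.smul_sum,
      TensorProduct.smul_tmul', TensorProduct.tmul_smul, smul_smul, mul_comm]
    exact Finset.sum_comm
  have := congrArg (fun f => TensorProduct.map (counitLeft k X) (counitLeft k X) ∘ₗ f) h.comul_cross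
  simp only [← LinearMap.comp_assoc, e, ← TensorProduct.map_comp, h.counitLeft_crossMap] at this
  rw [this, LinearMap.comp_assoc, h.counitLeft_crossMap]

/-- Projecting the first copy to its first factor and the second copy to its second gives `y₍₁₎ :
x₍₂₎ ⊗ x₍₁₎ · y₍₂₎ = y₍₂₎ : x₍₁₎ ⊗ x₍₂₎ · y₍₁₎`. This relates the two operations and is the source
of the rigidity used below. -/
theorem crossMap_eq (h : IsQMagmaCoalgebra p d) :
    crossMap p d =
    TensorProduct.map (TensorProduct.lift d.flip) (TensorProduct.lift p) ∘ₗ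
      tensorComul Coalgebra.comul (copComul k X) := by
  have e : TensorProduct.map (counitRight k X) (counitLeft k X) ∘ₗ
      tensorComul (copComul k X) Coalgebra.comul = LinearMap.id := by
    refine TensorProduct.ext' fun x y => ?_
    have r := Coalgebra.Repr.arbitrary k x
    have s := Coalgebra.Repr.arbitrary k y
    rw [LinearMap.comp_apply, tensorComul_tmul (copComul_eq_sum r) (comul_eq_sum s),
      LinearMap.id_apply]
    conv_rhs => rw [← Coalgebra.sum_counit_smul r, ← Coalgebra.sum_counit_smul s]
    simp only [map_sum, TensorProduct.map_tmul, counitLeft_tmul, counitRight_tmul,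
      TensorProduct.sum_tmul, TensorProduct.tmul_sum, TensorProduct.smul_tmul',
      TensorProduct.tmul_smul, Finset.smul_sum, smul_smul, mul_comm]
    exact Finset.sum_comm
  have := congrArg (fun f => TensorProduct.map (counitRight k X) (counitLeft k X) ∘ₗ f)
    h.comul_cross
  simp only [← LinearMap.comp_assoc, e, ← TensorProduct.map_comp, h.counitLeft_crossMap,
    h.counitRight_crossMap, LinearMap.id_comp] at this
  exact this.symm

/-- The cross map of `(d, p)` is that of `(p, d)` conjugated by the flip, and the flip carries `H ⊗
Hᶜᵒᵖ` to `Hᶜᵒᵖ ⊗ H`, which is also its co-opposite. -/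
theorem symm (h : IsQMagmaCoalgebra p d) : IsQMagmaCoalgebra d p where
  counit_dot := h.counit_ddot
  counit_ddot := h.counit_dot
  counit_cross := by
    refine TensorProduct.ext' fun x y => ?_
    have e := LinearMap.congr_fun h.counit_cross (y ⊗ₜ x)
    have e' : (LinearMap.mul' k k ∘ₗ TensorProduct.map
        (Coalgebra.counit (R := k) (A := X)) (Coalgebra.counit (R := k) (A := X))) ∘ₗ
        (TensorProduct.comm k X X).toLinearMap =
        LinearMap.mul' k k ∘ₗ TensorProduct.map Coalgebra.counit Coalgebra.counit := by
      refine TensorProduct.ext' fun x y => ?_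
      simp [mul_comm]
    rw [crossMap_swap, ← LinearMap.comp_assoc, e']
    simp only [LinearMap.comp_apply, LinearEquiv.coe_coe, TensorProduct.comm_tmul,
      TensorProduct.map_tmul, LinearMap.mul'_apply] at e ⊢
    rw [e, mul_comm]
  comul_cross := by
    have hc : (TensorProduct.comm k X X).toLinearMap ∘ₗ copComul k X = Coalgebra.comul := by
      ext x; simp [copComul]
    have e₃ : ∀ z, tensorComul (copComul k X) (Coalgebra.comul (R := k) (A := X)) z =
        TensorProduct.comm k (X ⊗[k] X) (X ⊗[k] X)
          (tensorComul Coalgebra.comul (copComul k X) z) := by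
      intro z
      rw [← tensorComul_comm_comp, hc]; rfl
    have e₄ : ∀ z, tensorComul (Coalgebra.comul (R := k) (A := X)) (copComul k X) z =
        TensorProduct.comm k (X ⊗[k] X) (X ⊗[k] X)
          (tensorComul (copComul k X) Coalgebra.comul z) := by
      intro z
      rw [← tensorComul_comm_comp, hc]; rfl
    have e₅ : ∀ z, TensorProduct.map (crossMap p d) (crossMap p d)
        (TensorProduct.comm k (X ⊗[k] X) (X ⊗[k] X) z) =
        TensorProduct.comm k (X ⊗[k] X) (X ⊗[k] X)
          (TensorProduct.map (crossMap p d) (crossMap p d) z) := by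
      intro z
      rw [TensorProduct.map_comm]
    have hx : ∀ z, TensorProduct.map (crossMap p d) (crossMap p d)
        (tensorComul Coalgebra.comul (copComul k X) z) =
        tensorComul (copComul k X) Coalgebra.comul (crossMap p d z) :=
      LinearMap.congr_fun h.comul_cross
    refine LinearMap.ext fun z => ?_
    rw [crossMap_swap p d]
    simp only [TensorProduct.map_comp, LinearMap.comp_apply, LinearEquiv.coe_coe]
    rw [tensorComul_comm, e₃ (TensorProduct.comm k X X z), e₅, hx,
      ← tensorComul_comm _ _ (crossMap p d (TensorProduct.comm k X X z)), e₄]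

end IsQMagmaCoalgebra

end

namespace RankOneDatum

noncomputable section

variable {k : Type u} {G : Type v} [Field k] [Group G] {D : RankOneDatum k G}

/-! ### Group-like and skew-primitive elements -/

/-- The product `s ⊗ t ↦ c_{g,i}(s) c_{h,l}(t)` of two coefficient functionals. -/
def coeffPair (D : RankOneDatum k G) (g : G) (i : ℕ) (h : G) (l : ℕ) :
    D.Alg ⊗[k] D.Alg →ₗ[k] k :=
  LinearMap.mul' k k ∘ₗ TensorProduct.map (D.coeff g i) (D.coeff h l)

theorem coeffPair_tmul (g : G) (i : ℕ) (h : G) (l : ℕ) (s t : D.Alg) :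
    D.coeffPair g i h l (s ⊗ₜ t) = D.coeff g i s * D.coeff h l t := rfl

/-- The convolution product of the dual basis functionals; it reduces conditions on `Δ s` to
equations between coefficients of `s`. -/
theorem coeffPair_comul [DecidableEq G] (g : G) (i : ℕ) (h : G) (l : ℕ) (s : D.Alg) :
    D.coeffPair g i h l (Coalgebra.comul s) =
      if i + l < D.n ∧ g * D.a ^ i = h then qBinom (D.χ D.a : k) (i + l) i * D.coeff g (i + l) s
      else 0 := by
  have key : D.coeffPair g i h l ∘ₗ Coalgebra.comul =
      (if i + l < D.n ∧ g * D.a ^ i = h then qBinom (D.χ D.a : k) (i + l) i else 0) •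
        D.coeff g (i + l) := by
    refine D.linearMap_ext_lt fun g' m hm => ?_
    rw [LinearMap.comp_apply, comul_mono, map_sum, LinearMap.smul_apply, smul_eq_mul,
      D.coeff_grp_mul_x_pow _ _ _ _ hm]
    have hr : ∀ r ∈ Finset.range (m + 1), D.coeffPair g i h l
        ((qBinom (D.χ D.a : k) m r • (D.grp g' * D.x ^ r)) ⊗ₜ[k]
          (D.grp (g' * D.a ^ r) * D.x ^ (m - r))) =
        if r = i then (if g' = g ∧ g * D.a ^ i = h ∧ m = i + l then
          qBinom (D.χ D.a : k) m i else 0) else 0 := by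
      intro r hr
      have hr' : r ≤ m := Nat.lt_succ_iff.1 (Finset.mem_range.1 hr)
      rw [coeffPair_tmul, map_smul, D.coeff_grp_mul_x_pow _ _ _ _ (by omega),
        D.coeff_grp_mul_x_pow _ _ _ _ (by omega)]
      by_cases h1 : r = i
      · subst h1
        by_cases h2 : g' = g
        · subst h2
          by_cases h3 : g' * D.a ^ r = h
          · by_cases h4 : m = r + l
            · have : m - r = l := by omega
              simp [h3, h4]
            · have : m - r ≠ l := by omega
              simp [h4, this]
          · simp [h3]
        · simp [h2]
      · simp [h1]
    rw [Finset.sum_congr rfl hr, Finset.sum_ite_eq']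
    by_cases h2 : g' = g
    · by_cases h3 : g * D.a ^ i = h
      · by_cases h4 : m = i + l
        · subst h4
          simp [h2, h3, hm]
        · simp [h4]
      · simp [h3]
    · simp [h2]
  have := LinearMap.congr_fun key s
  rw [LinearMap.comp_apply, LinearMap.smul_apply, smul_eq_mul, ite_mul, zero_mul] at this
  exact this

/-- The span of `G` in `H_D`. -/
def grpSpan (D : RankOneDatum k G) : Submodule k D.Alg := Submodule.span k (Set.range D.grp)

theorem grp_mem_grpSpan (g : G) : D.grp g ∈ D.grpSpan := Submodule.subset_span ⟨g, rfl⟩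

theorem mem_grpSpan [Finite G] {s : D.Alg} (h : ∀ g, ∀ j < D.n, j ≠ 0 → D.coeff g j s = 0) :
    s ∈ D.grpSpan := by
  cases nonempty_fintype G
  rw [← D.sum_coeff s]
  refine Submodule.sum_mem _ fun g _ => Submodule.sum_mem _ fun j hj => ?_
  rcases eq_or_ne j 0 with rfl | hj0
  · rw [pow_zero, mul_one]
    exact Submodule.smul_mem _ _ (grp_mem_grpSpan g)
  · rw [h g j (Finset.mem_range.1 hj) hj0, zero_smul]
    exact Submodule.zero_mem _

theorem coeff_eq_zero_of_mem_grpSpan {s : D.Alg} (hs : s ∈ D.grpSpan) (g : G) {j : ℕ}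
    (hj : j ≠ 0) : D.coeff g j s = 0 := by
  classical
  have : D.grpSpan ≤ LinearMap.ker (D.coeff g j) := by
    refine Submodule.span_le.2 ?_
    rintro _ ⟨h, rfl⟩
    simp [coeff_grp, hj.symm]
  exact this hs

theorem grp_a_mul_of_mem_grpSpan {s : D.Alg} (hs : s ∈ D.grpSpan) :
    s * D.grp D.a = D.grp D.a * s := by
  have : D.grpSpan ≤ LinearMap.ker
      (LinearMap.mulRight k (D.grp D.a) - LinearMap.mulLeft k (D.grp D.a)) := by
    refine Submodule.span_le.2 ?_
    rintro _ ⟨h, rfl⟩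
    simp [← map_mul, Subgroup.mem_center_iff.1 D.a_central h]
  exact sub_eq_zero.1 (this hs)

/-- The coefficients in positive degree vanish, and those in degree `0` are orthogonal idempotents
of `k`. The counit condition only excludes `s = 0`. -/
theorem exists_grp_eq [Finite G] {s : D.Alg} (hs : Coalgebra.comul (R := k) s = s ⊗ₜ s)
    (hε : Coalgebra.counit (R := k) s = 1) : ∃ g, s = D.grp g := by
  classical
  cases nonempty_fintype G
  have h : ∀ g i h l, D.coeff g i s * D.coeff h l s =
      if i + l < D.n ∧ g * D.a ^ i = h then
        qBinom (D.χ D.a : k) (i + l) i * D.coeff g (i + l) s else 0 := fun g i h l => by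
    rw [← coeffPair_comul, hs, coeffPair_tmul]
  -- Descending induction on `m`: the square of the coefficient at `(g, m)` is zero or a multiple of
  -- the coefficient at `(g, 2m)`.
  have h0 : ∀ N g m, m ≠ 0 → D.n ≤ m + N → D.coeff g m s = 0 := by
    intro N
    induction N with
    | zero =>
      intro g m hm hN
      have e := h g m g m
      rw [if_neg (by omega)] at e
      exact mul_self_eq_zero.1 e
    | succ N ih =>
      intro g m hm hN
      have e := h g m g m
      rw [ih g (m + m) (by omega) (by omega), mul_zero, ite_self] at e
      exact mul_self_eq_zero.1 e
  have h1 : ∀ g h, D.coeff g 0 s * D.coeff h 0 s = if g = h then D.coeff g 0 s else 0 := by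
    intro g g'
    rw [h]
    simp [D.n_pos, qBinom_zero_right]
  have hs' : s = ∑ g : G, D.coeff g 0 s • D.grp g := by
    conv_lhs => rw [← D.sum_coeff s]
    refine Finset.sum_congr rfl fun g _ => ?_
    rw [Finset.sum_eq_single 0]
    · rw [pow_zero, mul_one]
    · intro j _ hj
      rw [h0 D.n g j hj (by omega), zero_smul]
    · intro hn
      exact absurd (Finset.mem_range.2 D.n_pos) hn
  obtain ⟨g, hg⟩ : ∃ g, D.coeff g 0 s ≠ 0 := by
    by_contra! hne
    rw [hs'] at hε
    simp [hne] at hε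
  refine ⟨g, ?_⟩
  have hg1 : D.coeff g 0 s = 1 := by
    have := h1 g g
    rw [if_pos rfl] at this
    exact mul_left_cancel₀ hg (by rw [this, mul_one])
  rw [hs', Finset.sum_eq_single g]
  · rw [hg1, one_smul]
  · intro h' _ hne
    have := h1 g h'
    rw [if_neg hne.symm, hg1, one_mul] at this
    rw [this, zero_smul]
  · simp

theorem qBinom_one_ne_zero {q : k} {n : ℕ} (hq : IsPrimitiveRoot q n) {j : ℕ} (h0 : 0 < j)
    (hn : j < n) : qBinom q j 1 ≠ 0 := by
  obtain ⟨m, rfl⟩ : ∃ m, j = m + 1 := ⟨j - 1, by omega⟩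
  intro h
  have e := qBinom_succ_mul q m 0
  rw [zero_add, h, mul_zero, qBinom_zero_right, mul_one] at e
  exact hq.pow_ne_one_of_pos_of_lt h0.ne' hn (sub_eq_zero.1 e.symm)

theorem skewPrimitive_coeff {s : D.Alg} {b : G}
    (hs : Coalgebra.comul (R := k) s = s ⊗ₜ D.grp b + 1 ⊗ₜ s) :
    (∀ g, ∀ j < D.n, j ≠ 0 → (g, j) ≠ (1, 1) → D.coeff g j s = 0) ∧
      (b ≠ D.a → D.coeff 1 1 s = 0) := by
  classical
  have h : ∀ g i h l, D.coeff g i s * D.coeff h l (D.grp b) + D.coeff g i 1 * D.coeff h l s =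
      if i + l < D.n ∧ g * D.a ^ i = h then
        qBinom (D.χ D.a : k) (i + l) i * D.coeff g (i + l) s else 0 := fun g i h l => by
    rw [← coeffPair_comul, hs, map_add, coeffPair_tmul, coeffPair_tmul]
  have h1 : ∀ g i, D.coeff g i (1 : D.Alg) = if 1 = g ∧ 0 = i then 1 else 0 := fun g i => by
    rw [← map_one D.grp, coeff_grp]
  have hn : 1 < D.n := D.one_lt_order
  refine ⟨fun g j hj hj0 hne => ?_, fun hb => ?_⟩
  · rcases eq_or_ne j 1 with rfl | hj1
    · have e := h g 0 g 1
      have hg : 1 ≠ g := fun hg => hne (by rw [hg])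
      simpa [coeff_grp, h1, hg, hn, qBinom_zero_right] using e.symm
    -- For `j ≥ 2` the component in bidegree `(1, j - 1)` of the skew-primitive expression is zero,
    -- while in `Δ s` it carries the nonzero factor `(qʲ - 1)/(q - 1)`.
    · have e := h g 1 (g * D.a) (j - 1)
      have h2 : 1 + (j - 1) = j := by omega
      have h3 : 0 ≠ j - 1 := by omega
      rw [h2] at e
      simp only [coeff_grp, h1, h3, hj, and_false, if_false, mul_zero, zero_add, pow_one,
        and_self, if_true, zero_ne_one, zero_mul] at e
      exact (mul_eq_zero.1 e.symm).resolve_left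
        (qBinom_one_ne_zero D.isPrimitiveRoot (by omega) hj)
  -- The monomial `x` contributes `x ⊗ a` to `Δ s`, which `s ⊗ b` cannot match when `b ≠ a`.
  · have e := h 1 1 D.a 0
    simpa [coeff_grp, h1, hb, hn, qBinom_self] using e.symm

theorem skewPrimitive_sub_mem [Finite G] {s : D.Alg} {b : G}
    (hs : Coalgebra.comul (R := k) s = s ⊗ₜ D.grp b + 1 ⊗ₜ s) :
    s - D.coeff 1 1 s • D.x ∈ D.grpSpan := by
  classical
  refine mem_grpSpan fun g j hj hj0 => ?_
  rw [map_sub, map_smul, coeff_x]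
  by_cases h : (g, j) = (1, 1)
  · obtain ⟨rfl, rfl⟩ := Prod.mk.inj h
    simp
  · rw [(skewPrimitive_coeff hs).1 g j hj hj0 h, if_neg, smul_zero, sub_zero]
    rintro ⟨rfl, rfl⟩
    exact h rfl

/-! ### The structure of Hopf q-braces with `x · x = x : x = 0` -/

/-- The part of the axioms of a Hopf q-brace that concerns the first operation. -/
structure HalfQBrace (p d : D.Alg →ₗ[k] D.Alg →ₗ[k] D.Alg) : Prop where
  magma : IsQMagmaCoalgebra p d
  one : ∀ h : D.Alg, p h 1 = h
  mul : ∀ h l m : D.Alg, p h (l * m) = p (p h m) l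
  mul_left : ∀ h l m : D.Alg, p (h * l) m =
    LinearMap.mul' k D.Alg (LinearMap.rTensor D.Alg (p h) (crossMap p d (l ⊗ₜ m)))

namespace HalfQBrace

variable {p d : D.Alg →ₗ[k] D.Alg →ₗ[k] D.Alg}

theorem exists_dot [Finite G] (hp : HalfQBrace p d) :
    ∃ dot : G → G → G, ∀ h g, p (D.grp h) (D.grp g) = D.grp (dot h g) := by
  have : ∀ h g, ∃ l, p (D.grp h) (D.grp g) = D.grp l := fun h g => by
    refine exists_grp_eq ?_ ?_
    · have e := LinearMap.congr_fun hp.magma.comul_dot (D.grp h ⊗ₜ D.grp g)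
      simpa [tensorComul, copComul, comul_grp] using e
    · rw [hp.magma.counit_dot, counit_grp, counit_grp, mul_one]
  choose dot hdot using this
  exact ⟨dot, hdot⟩

variable {dot ddot : G → G → G}

theorem dot_one (hp : HalfQBrace p d) (hdot : ∀ h g, p (D.grp h) (D.grp g) = D.grp (dot h g))
    (g : G) : dot g 1 = g :=
  D.grp_injective (by rw [← hdot, map_one, hp.one])

theorem dot_mul (hp : HalfQBrace p d) (hdot : ∀ h g, p (D.grp h) (D.grp g) = D.grp (dot h g))
    (g h l : G) : dot g (h * l) = dot (dot g l) h :=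
  D.grp_injective (by rw [← hdot, ← hdot, ← hdot, map_mul, hp.mul])

/-- The module law makes the action of `g⁻¹` inverse to that of `g`. -/
theorem bijective_dot (hp : HalfQBrace p d)
    (hdot : ∀ h g, p (D.grp h) (D.grp g) = D.grp (dot h g)) (g : G) :
    Function.Bijective fun h => dot h g :=
  Function.bijective_iff_has_inverse.2 ⟨fun h => dot h g⁻¹,
    fun h => by simp only [← hp.dot_mul hdot, inv_mul_cancel, hp.dot_one hdot],
    fun h => by simp only [← hp.dot_mul hdot, mul_inv_cancel, hp.dot_one hdot]⟩

theorem mul_dot (hp : HalfQBrace p d) (hdot : ∀ h g, p (D.grp h) (D.grp g) = D.grp (dot h g))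
    (hddot : ∀ h g, d (D.grp h) (D.grp g) = D.grp (ddot h g)) (g h l : G) :
    dot (g * h) l = dot g (ddot l h) * dot h l := by
  refine D.grp_injective ?_
  rw [← hdot, map_mul, hp.mul_left]
  simp [crossMap, tensorComul, copComul, comul_grp, hdot, hddot]

theorem one_dot (hp : HalfQBrace p d) (hd : HalfQBrace d p)
    (hdot : ∀ h g, p (D.grp h) (D.grp g) = D.grp (dot h g))
    (hddot : ∀ h g, d (D.grp h) (D.grp g) = D.grp (ddot h g)) (g : G) : dot 1 g = 1 := by
  have e := hp.mul_dot hdot hddot 1 1 g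
  rw [one_mul, hd.dot_one hddot] at e
  exact left_eq_mul.1 e

theorem one_apply (hp : HalfQBrace p d) (hd : HalfQBrace d p)
    (hdot : ∀ h g, p (D.grp h) (D.grp g) = D.grp (dot h g))
    (hddot : ∀ h g, d (D.grp h) (D.grp g) = D.grp (ddot h g)) (g : G) :
    p 1 (D.grp g) = 1 := by
  rw [← map_one D.grp, hdot, hp.one_dot hd hdot hddot]

theorem comul_x_apply (hp : HalfQBrace p d) (hd : HalfQBrace d p)
    (hdot : ∀ h g, p (D.grp h) (D.grp g) = D.grp (dot h g))
    (hddot : ∀ h g, d (D.grp h) (D.grp g) = D.grp (ddot h g)) (g : G) :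
    Coalgebra.comul (R := k) (p D.x (D.grp g)) =
      p D.x (D.grp g) ⊗ₜ D.grp (dot D.a g) + 1 ⊗ₜ p D.x (D.grp g) := by
  have e := LinearMap.congr_fun hp.magma.comul_dot (D.x ⊗ₜ D.grp g)
  simpa [tensorComul, copComul, comul_grp, comul_x, TensorProduct.add_tmul, hdot,
    hp.one_apply hd hdot hddot] using e

theorem apply_mem_grpSpan (hdot : ∀ h g, p (D.grp h) (D.grp g) = D.grp (dot h g)) {s : D.Alg}
    (hs : s ∈ D.grpSpan) (g : G) : p s (D.grp g) ∈ D.grpSpan := by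
  have : D.grpSpan ≤ D.grpSpan.comap (p.flip (D.grp g)) := by
    refine Submodule.span_le.2 ?_
    rintro _ ⟨h, rfl⟩
    simp [hdot, grp_mem_grpSpan]
  exact this hs

/-- Otherwise `x · g` would lie in `k[G]`, and acting by `g⁻¹` would put `x` in `k[G]`. -/
theorem coeff_x_apply_ne_zero [Finite G] (hp : HalfQBrace p d) (hd : HalfQBrace d p)
    (hdot : ∀ h g, p (D.grp h) (D.grp g) = D.grp (dot h g))
    (hddot : ∀ h g, d (D.grp h) (D.grp g) = D.grp (ddot h g)) (g : G) :
    D.coeff 1 1 (p D.x (D.grp g)) ≠ 0 := by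
  classical
  intro h
  have h1 := skewPrimitive_sub_mem (hp.comul_x_apply hd hdot hddot g)
  rw [h, zero_smul, sub_zero] at h1
  have h2 := apply_mem_grpSpan hdot h1 g⁻¹
  rw [← hp.mul, ← map_mul, inv_mul_cancel, map_one, hp.one] at h2
  have h3 := coeff_eq_zero_of_mem_grpSpan h2 1 one_ne_zero
  rw [coeff_x] at h3
  simp at h3

theorem a_dot [Finite G] (hp : HalfQBrace p d) (hd : HalfQBrace d p)
    (hdot : ∀ h g, p (D.grp h) (D.grp g) = D.grp (dot h g))
    (hddot : ∀ h g, d (D.grp h) (D.grp g) = D.grp (ddot h g)) (g : G) : dot D.a g = D.a := by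
  by_contra hne
  exact hp.coeff_x_apply_ne_zero hd hdot hddot g
    ((skewPrimitive_coeff (hp.comul_x_apply hd hdot hddot g)).2 hne)

theorem a_ne_one (D : RankOneDatum k G) : D.a ≠ 1 := by
  intro h
  have := D.one_lt_order
  rw [h, map_one, orderOf_one] at this
  exact lt_irrefl _ this

/-- At `x ⊗ g` the two forms of the cross map read `(g : a) ⊗ (x · g) + (g : x) ⊗ 1 = (g : x) ⊗ a +
g ⊗ (x · g)`. -/
theorem ddot_a_and_grp_ddot_x [Finite G] (hp : HalfQBrace p d) (hd : HalfQBrace d p)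
    (hdot : ∀ h g, p (D.grp h) (D.grp g) = D.grp (dot h g))
    (hddot : ∀ h g, d (D.grp h) (D.grp g) = D.grp (ddot h g)) (g : G) :
    ddot g D.a = g ∧ d (D.grp g) D.x = 0 := by
  classical
  have e := LinearMap.congr_fun hp.magma.crossMap_eq (D.x ⊗ₜ D.grp g)
  simp only [crossMap, tensorComul, copComul, LinearMap.comp_apply, LinearEquiv.coe_coe, comul_grp,
    comul_x, TensorProduct.map_tmul, map_add, TensorProduct.comm_tmul, TensorProduct.add_tmul,
    TensorProduct.tensorTensorTensorComm_tmul, TensorProduct.lift.tmul, LinearMap.flip_apply,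
    hdot, hddot, hp.a_dot hd hdot hddot, hp.one_apply hd hdot hddot, hd.one] at e
  have hc0 : D.coeff 1 1 (p D.x (D.grp g)) ≠ 0 := hp.coeff_x_apply_ne_zero hd hdot hddot g
  -- The coefficient of `x` in the second factor isolates the terms with `x · g`, where it is
  -- nonzero.
  have e1 := congrArg ((TensorProduct.rid k D.Alg).toLinearMap ∘ₗ
    LinearMap.lTensor D.Alg (D.coeff 1 1)) e
  have hone : ∀ j, D.coeff 1 j (1 : D.Alg) = if 0 = j then 1 else 0 := fun j => by
    rw [← map_one D.grp, coeff_grp]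
    simp
  simp [coeff_grp, hone] at e1
  have hg : ddot g D.a = g := D.grp_injective (smul_right_injective D.Alg hc0 e1)
  refine ⟨hg, ?_⟩
  -- Once `g : a = g`, the terms with `x · g` cancel, and the coefficient of `1` separates `1` from
  -- `a`.
  have e2 := congrArg ((TensorProduct.rid k D.Alg).toLinearMap ∘ₗ
    LinearMap.lTensor D.Alg (D.coeff 1 0)) e
  simpa [coeff_grp, hone, hg, a_ne_one D] using e2

theorem crossMap_x_grp
    (hddot : ∀ h g, d (D.grp h) (D.grp g) = D.grp (ddot h g)) {g : G} (hg : ddot g D.a = g)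
    (hx : d (D.grp g) D.x = 0) :
    crossMap p d (D.x ⊗ₜ D.grp g) = D.grp g ⊗ₜ p D.x (D.grp g) := by
  simp [crossMap, tensorComul, copComul, comul_grp, comul_x, TensorProduct.add_tmul, hddot, hg, hx]

/-- Let `m` act on both sides of `x g = χ(g) g x` and expand each product by the multiplicativity
law. -/
theorem chi_smul_mul_x_apply [Finite G] (hp : HalfQBrace p d) (hd : HalfQBrace d p)
    (hdot : ∀ h g, p (D.grp h) (D.grp g) = D.grp (dot h g))
    (hddot : ∀ h g, d (D.grp h) (D.grp g) = D.grp (ddot h g)) (g m : G) :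
    (D.χ g : k) • (D.grp (dot g m) * p D.x (D.grp m)) =
      p D.x (D.grp (ddot m g)) * D.grp (dot g m) := by
  obtain ⟨hm, hx⟩ := hp.ddot_a_and_grp_ddot_x hd hdot hddot m
  have e := congrArg (fun z => p z (D.grp m)) (D.x_mul_grp g)
  simp only [map_smul, LinearMap.smul_apply, hp.mul_left, crossMap_x_grp hddot hm hx] at e
  simp only [LinearMap.rTensor_tmul, LinearMap.mul'_apply, hdot] at e
  rw [← e]
  simp [crossMap, tensorComul, copComul, comul_grp, hdot, hddot]

/-- Both `x · g` and `c x` satisfy `w a = χ(a) a w`, hence so does their difference. The latter lies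
in `k[G]` and commutes with the central `a`, so it vanishes because `χ(a) ≠ 1`. -/
theorem x_apply [Finite G] (hp : HalfQBrace p d) (hd : HalfQBrace d p)
    (hdot : ∀ h g, p (D.grp h) (D.grp g) = D.grp (dot h g))
    (hddot : ∀ h g, d (D.grp h) (D.grp g) = D.grp (ddot h g)) (g : G) :
    p D.x (D.grp g) = D.coeff 1 1 (p D.x (D.grp g)) • D.x := by
  have e := hp.chi_smul_mul_x_apply hd hdot hddot D.a g
  rw [(hp.ddot_a_and_grp_ddot_x hd hdot hddot g).1, hp.a_dot hd hdot hddot] at e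
  have hv := skewPrimitive_sub_mem (hp.comul_x_apply hd hdot hddot g)
  have hva := grp_a_mul_of_mem_grpSpan hv
  set c := D.coeff 1 1 (p D.x (D.grp g))
  set w := p D.x (D.grp g)
  have hw : (D.χ D.a : k) • (D.grp D.a * (w - c • D.x)) = D.grp D.a * (w - c • D.x) := by
    rw [← hva]
    nth_rw 1 [hva]
    rw [mul_sub, sub_mul, smul_sub, e, smul_mul_assoc, x_mul_grp, mul_smul_comm, smul_comm c]
  have hq : (D.χ D.a : k) - 1 ≠ 0 := fun h =>
    D.isPrimitiveRoot.pow_ne_one_of_pos_of_lt one_ne_zero D.one_lt_order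
      (by rw [pow_one]; exact sub_eq_zero.1 h)
  have h0 : D.grp D.a * (w - c • D.x) = 0 := by
    have h : ((D.χ D.a : k) - 1) • (D.grp D.a * (w - c • D.x)) = 0 := by
      rw [sub_smul, one_smul, hw, sub_self]
    exact (smul_eq_zero.1 h).resolve_left hq
  have h1 := congrArg (fun z => D.grp D.a⁻¹ * z) h0
  simp only [← mul_assoc, ← map_mul, inv_mul_cancel, map_one, one_mul, mul_zero] at h1
  exact sub_eq_zero.1 h1

/-- The character `λ` with `x · g = λ(g) x`. -/
def character [Finite G] (hp : HalfQBrace p d) (hd : HalfQBrace d p)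
    (hdot : ∀ h g, p (D.grp h) (D.grp g) = D.grp (dot h g))
    (hddot : ∀ h g, d (D.grp h) (D.grp g) = D.grp (ddot h g)) : G →* kˣ :=
  MonoidHom.toHomUnits
    { toFun := fun g => D.coeff 1 1 (p D.x (D.grp g))
      map_one' := by
        classical
        simp [hp.one, coeff_x]
      map_mul' := fun g h => by
        have e := congrArg (fun z => D.coeff 1 1 (p z (D.grp g))) (hp.x_apply hd hdot hddot h)
        simp only [map_smul, LinearMap.smul_apply, smul_eq_mul] at e
        rw [map_mul, hp.mul, e, mul_comm] }

theorem x_apply_eq_character [Finite G] (hp : HalfQBrace p d) (hd : HalfQBrace d p)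
    (hdot : ∀ h g, p (D.grp h) (D.grp g) = D.grp (dot h g))
    (hddot : ∀ h g, d (D.grp h) (D.grp g) = D.grp (ddot h g)) (g : G) :
    p D.x (D.grp g) = (hp.character hd hdot hddot g : k) • D.x :=
  hp.x_apply hd hdot hddot g

theorem mono_grp [Finite G] (hp : HalfQBrace p d) (hd : HalfQBrace d p)
    (hdot : ∀ h g, p (D.grp h) (D.grp g) = D.grp (dot h g))
    (hddot : ∀ h g, d (D.grp h) (D.grp g) = D.grp (ddot h g)) (h g : G) (j : ℕ) :
    p (D.grp h * D.x ^ j) (D.grp g) =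
      (hp.character hd hdot hddot g : k) ^ j • (D.grp (dot h g) * D.x ^ j) := by
  obtain ⟨hm, hx⟩ := hp.ddot_a_and_grp_ddot_x hd hdot hddot g
  induction j with
  | zero => simp [hdot]
  | succ j ih =>
    rw [pow_succ, ← mul_assoc, hp.mul_left, crossMap_x_grp hddot hm hx,
      hp.x_apply_eq_character hd hdot hddot, LinearMap.rTensor_tmul, LinearMap.mul'_apply, ih,
      smul_mul_assoc, mul_smul_comm, smul_smul, pow_succ, ← mul_assoc, ← pow_succ]

theorem crossMap_x_x [Finite G] (hp : HalfQBrace p d) (hd : HalfQBrace d p)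
    (hdot : ∀ h g, p (D.grp h) (D.grp g) = D.grp (dot h g))
    (hddot : ∀ h g, d (D.grp h) (D.grp g) = D.grp (ddot h g))
    (hpx : p D.x D.x = 0) (hdx : d D.x D.x = 0) :
    crossMap p d (D.x ⊗ₜ D.x) = ((hp.character hd hdot hddot D.a : k) *
      (hd.character hp hddot hdot D.a : k)) • (D.x ⊗ₜ D.x) := by
  have h1 : d 1 D.x = 0 := by
    have := (hp.ddot_a_and_grp_ddot_x hd hdot hddot 1).2
    rwa [map_one] at this
  simp [crossMap, tensorComul, copComul, comul_x, TensorProduct.add_tmul, TensorProduct.tmul_add,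
    hpx, hdx, h1, hp.x_apply_eq_character hd hdot hddot, hd.x_apply_eq_character hp hddot hdot,
    TensorProduct.tmul_smul, ← TensorProduct.smul_tmul', smul_smul]

/-- At `x ⊗ x` one form of the cross map gives `λ(a) ξ(a) x ⊗ x`, the other gives `(x : 1) ⊗ (x · 1)
= x ⊗ x`. -/
theorem character_mul_character [Finite G] (hp : HalfQBrace p d) (hd : HalfQBrace d p)
    (hdot : ∀ h g, p (D.grp h) (D.grp g) = D.grp (dot h g))
    (hddot : ∀ h g, d (D.grp h) (D.grp g) = D.grp (ddot h g))
    (hpx : p D.x D.x = 0) (hdx : d D.x D.x = 0) :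
    hp.character hd hdot hddot D.a * hd.character hp hddot hdot D.a = 1 := by
  classical
  have e := LinearMap.congr_fun hp.magma.crossMap_eq (D.x ⊗ₜ D.x)
  have h1 : p D.x 1 = D.x := hp.one _
  have h2 : d D.x 1 = D.x := hd.one _
  have h3 : d (D.grp D.a) D.x = 0 := (hp.ddot_a_and_grp_ddot_x hd hdot hddot D.a).2
  rw [hp.crossMap_x_x hd hdot hddot hpx hdx] at e
  simp only [tensorComul, copComul, LinearMap.comp_apply, LinearEquiv.coe_coe, comul_x,
    TensorProduct.map_tmul, map_add, TensorProduct.comm_tmul, TensorProduct.add_tmul,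
    TensorProduct.tmul_add, TensorProduct.tensorTensorTensorComm_tmul, TensorProduct.lift.tmul,
    LinearMap.flip_apply, hpx, hdx, h1, h2, h3, TensorProduct.zero_tmul, TensorProduct.tmul_zero,
    zero_add] at e
  have e' := congrArg (D.coeffPair 1 1 1 1) e
  simp only [map_smul, coeffPair_tmul, coeff_x, and_self, if_true, mul_one, smul_eq_mul] at e'
  exact Units.ext e'

theorem chi_mul_character [Finite G] (hp : HalfQBrace p d) (hd : HalfQBrace d p)
    (hdot : ∀ h g, p (D.grp h) (D.grp g) = D.grp (dot h g))
    (hddot : ∀ h g, d (D.grp h) (D.grp g) = D.grp (ddot h g)) (h l : G) :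
    D.χ h * hp.character hd hdot hddot l =
      hp.character hd hdot hddot (ddot l h) * D.χ (dot h l) := by
  classical
  have e := hp.chi_smul_mul_x_apply hd hdot hddot h l
  rw [hp.x_apply_eq_character hd hdot hddot, hp.x_apply_eq_character hd hdot hddot, mul_smul_comm,
    smul_mul_assoc, x_mul_grp, smul_smul, smul_smul] at e
  have e' := congrArg (D.coeff (dot h l) 1) e
  have hx := D.coeff_grp_mul_x_pow (dot h l) (dot h l) 1 1 D.one_lt_order
  rw [pow_one, if_pos ⟨rfl, rfl⟩] at hx
  simp only [map_smul, hx, smul_eq_mul, mul_one] at e'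
  exact Units.ext e'

/-- Starting from `h · x = 0`, the cross map at `x ⊗ x` makes `(h xʲ⁺¹) · x` a multiple of `((h xʲ)
· x) x`. -/
theorem apply_x [Finite G] (hp : HalfQBrace p d) (hd : HalfQBrace d p)
    (hdot : ∀ h g, p (D.grp h) (D.grp g) = D.grp (dot h g))
    (hddot : ∀ h g, d (D.grp h) (D.grp g) = D.grp (ddot h g))
    (hpx : p D.x D.x = 0) (hdx : d D.x D.x = 0) (s : D.Alg) : p s D.x = 0 := by
  have : p.flip D.x = 0 := by
    refine D.linearMap_ext fun h j => ?_
    rw [LinearMap.flip_apply, LinearMap.zero_apply]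
    induction j with
    | zero => rw [pow_zero, mul_one, (hd.ddot_a_and_grp_ddot_x hp hddot hdot h).2]
    | succ j ih =>
      rw [pow_succ, ← mul_assoc, hp.mul_left, hp.crossMap_x_x hd hdot hddot hpx hdx, map_smul,
        map_smul, LinearMap.rTensor_tmul, ih, LinearMap.mul'_apply, zero_mul, smul_zero]
  exact LinearMap.congr_fun this s

theorem givenBy [Finite G] (hp : HalfQBrace p d) (hd : HalfQBrace d p)
    (hdot : ∀ h g, p (D.grp h) (D.grp g) = D.grp (dot h g))
    (hddot : ∀ h g, d (D.grp h) (D.grp g) = D.grp (ddot h g))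
    (hpx : p D.x D.x = 0) (hdx : d D.x D.x = 0) :
    D.GivenBy p dot (hp.character hd hdot hddot) := by
  intro h g j i
  split_ifs with hi
  · rw [hi, pow_zero, mul_one, hp.mono_grp hd hdot hddot]
  · obtain ⟨i, rfl⟩ := Nat.exists_eq_succ_of_ne_zero hi
    rw [Nat.succ_eq_add_one, pow_succ, ← mul_assoc, hp.mul, hp.apply_x hd hdot hddot hpx hdx,
      map_zero, LinearMap.zero_apply]

end HalfQBrace

end

end RankOneDatum

/-! ### Assembling the two directions -/

theorem IsHopfQBrace.half {k : Type u} {G : Type v} [Field k] [Group G] {D : RankOneDatum k G}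
    {p d : D.Alg →ₗ[k] D.Alg →ₗ[k] D.Alg} (h : IsHopfQBrace p d) :
    RankOneDatum.HalfQBrace p d :=
  ⟨h.toIsQMagmaCoalgebra, h.dot_one, h.dot_mul, h.mul_dot⟩

theorem IsHopfQBrace.half_symm {k : Type u} {G : Type v} [Field k] [Group G]
    {D : RankOneDatum k G} {p d : D.Alg →ₗ[k] D.Alg →ₗ[k] D.Alg} (h : IsHopfQBrace p d) :
    RankOneDatum.HalfQBrace d p :=
  ⟨h.toIsQMagmaCoalgebra.symm, h.ddot_one, h.ddot_mul, h.mul_ddot⟩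

namespace RankOneDatum

theorem sweedler_grp {k : Type u} {G : Type v} [Field k] [Group G] {D : RankOneDatum k G}
    (B : D.Alg →ₗ[k] D.Alg →ₗ[k] D.Alg) (g : G) :
    sweedler B (D.grp g) = B (D.grp g) (D.grp g) := by
  simp [sweedler, comul_grp]

theorem exists_of_isHopfQBrace {k : Type u} {G : Type v} [Field k] [Group G] [Finite G]
    {D : RankOneDatum k G} {p d : D.Alg →ₗ[k] D.Alg →ₗ[k] D.Alg} (h : IsHopfQBrace p d)
    (hpx : p D.x D.x = 0) (hdx : d D.x D.x = 0) :
    ∃ dot ddot : G → G → G,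
      (∀ h g : G, p (D.grp h) (D.grp g) = D.grp (dot h g)) ∧
      (∀ h g : G, d (D.grp h) (D.grp g) = D.grp (ddot h g)) ∧
      IsQBrace dot ddot ∧ D.FixesA dot ddot ∧
      ∃ lam xi : G →* kˣ, D.CompatibleCharacters dot ddot lam xi ∧
        D.GivenBy p dot lam ∧ D.GivenBy d ddot xi := by
  classical
  have hp := h.half
  have hd := h.half_symm
  obtain ⟨dot, hdot⟩ := hp.exists_dot
  obtain ⟨ddot, hddot⟩ := hd.exists_dot
  have c1 := fun u v w => by
    simpa only [sweedler_grp, LinearMap.flip_apply, LinearMap.compl₁₂_apply] using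
      h.cycle_one u (D.grp v) (D.grp w)
  have c2 := fun u v w => by
    simpa only [sweedler_grp, LinearMap.flip_apply, LinearMap.compl₁₂_apply] using
      h.cycle_two u (D.grp v) (D.grp w)
  have c3 := fun u v w => by
    simpa only [sweedler_grp, LinearMap.flip_apply, LinearMap.compl₁₂_apply] using
      h.cycle_three u (D.grp v) (D.grp w)
  have hpa := hp.x_apply_eq_character hd hdot hddot
  have hda := hd.x_apply_eq_character hp hddot hdot
  have hx : ∀ {r s : kˣ}, (r : k) • D.x = (s : k) • D.x → r = s := by
    intro r s hrs
    have := congrArg (D.coeff 1 1) hrs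
    simp only [map_smul, coeff_x, and_self, if_true, smul_eq_mul, mul_one] at this
    exact Units.ext this
  refine ⟨dot, ddot, hdot, hddot, ?_, ?_, hp.character hd hdot hddot, hd.character hp hddot hdot,
    ?_, hp.givenBy hd hdot hddot hpx hdx, hd.givenBy hp hddot hdot hdx hpx⟩
  · exact
      { left_regular := hp.bijective_dot hdot
        right_regular := hd.bijective_dot hddot
        cycle_one := fun u v w => D.grp_injective (by
          simpa only [hdot, hddot] using c1 (D.grp u) v w)
        cycle_two := fun u v w => D.grp_injective (by
          simpa only [hdot, hddot] using c2 (D.grp u) v w)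
        cycle_three := fun u v w => D.grp_injective (by
          simpa only [hdot, hddot] using c3 (D.grp u) v w)
        dot_one := hp.dot_one hdot
        dot_mul := hp.dot_mul hdot
        ddot_one := hd.dot_one hddot
        ddot_mul := hd.dot_mul hddot
        mul_dot := hp.mul_dot hdot hddot
        mul_ddot := hd.mul_dot hddot hdot }
  · exact fun g => ⟨hp.a_dot hd hdot hddot g, hd.a_dot hp hddot hdot g,
      (hd.ddot_a_and_grp_ddot_x hp hddot hdot g).1, (hp.ddot_a_and_grp_ddot_x hd hdot hddot g).1⟩
  · exact
      -- Conditions 2–4 are the cycle identities at `u = x` with `v, w ∈ G`, read off from the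
      -- coefficient of `x`.
      { one := eq_inv_of_mul_eq_one_left (hp.character_mul_character hd hdot hddot hpx hdx)
        two := fun a b => by
          have e := c1 D.x a b
          simp only [hpa, hdot, hddot, map_smul, LinearMap.smul_apply, smul_smul,
            ← Units.val_mul] at e
          simpa only [map_mul] using hx e
        three := fun a b => by
          have e := c2 D.x a b
          simp only [hpa, hda, hdot, hddot, map_smul, LinearMap.smul_apply, smul_smul,
            ← Units.val_mul] at e
          exact hx e
        four := fun a b => by
          have e := c3 D.x a b
          simp only [hda, hdot, hddot, map_smul, LinearMap.smul_apply, smul_smul,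
            ← Units.val_mul] at e
          simpa only [map_mul] using (hx e).symm
        five := hp.chi_mul_character hd hdot hddot
        six := hd.chi_mul_character hp hddot hdot }

end RankOneDatum

theorem theorem3p2 {k : Type*} {G : Type*} [Field k] [IsAlgClosed k] [CharZero k]
    [Group G] [Finite G] (D : RankOneDatum k G) :
    (∀ p d : D.Alg →ₗ[k] D.Alg →ₗ[k] D.Alg, IsHopfQBrace p d →
      p D.x D.x = 0 → d D.x D.x = 0 →
      ∃ dot ddot : G → G → G,
        (∀ h g : G, p (D.grp h) (D.grp g) = D.grp (dot h g)) ∧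
        (∀ h g : G, d (D.grp h) (D.grp g) = D.grp (ddot h g)) ∧
        IsQBrace dot ddot ∧ D.FixesA dot ddot ∧
        ∃ lam xi : G →* kˣ, D.CompatibleCharacters dot ddot lam xi ∧
          D.GivenBy p dot lam ∧ D.GivenBy d ddot xi) ∧
    (∀ dot ddot : G → G → G, IsQBrace dot ddot → D.FixesA dot ddot →
      ∀ lam xi : G →* kˣ, D.CompatibleCharacters dot ddot lam xi →
        (∀ p d : D.Alg →ₗ[k] D.Alg →ₗ[k] D.Alg,
          D.GivenBy p dot lam → D.GivenBy d ddot xi → IsHopfQBrace p d) ∧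
        ((∃! pd : (D.Alg →ₗ[k] D.Alg →ₗ[k] D.Alg) × (D.Alg →ₗ[k] D.Alg →ₗ[k] D.Alg),
            D.GivenBy pd.1 dot lam ∧ D.GivenBy pd.2 ddot xi) ↔
          (D.α • (D.grp D.a ^ D.n - 1) = 0 ∨ (lam ^ D.n = 1 ∧ xi ^ D.n = 1)))) :=
  ⟨fun _ _ h hpx hdx => RankOneDatum.exists_of_isHopfQBrace h hpx hdx,
    fun _ _ hq hf _ _ hc => ⟨fun _ _ hp hd => hp.isHopfQBrace hd hq hf hc,
      RankOneDatum.existsUnique_givenBy_iff hq hf⟩⟩
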